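/- Let $n\ge 1$ and let $\Omega\subset\subset\mathbb C^n$ be a bounded domain with smooth boundary and smooth defining function $r$; that is, $r$ is a real $C^\infty$ function on an open neighborhood $U$ of $\overline\Omega$, $\Omega=\{z\in U: r(z)<0\}$, and $dr\neq 0$ on $b\Omega$. For $\delta>0$ put $\Omega_\delta:=\{z\in\Omega:\operatorname{dist}(z,b\Omega)>\delta\}$. For a plurisubharmonic function $u:\Omega\to[-\infty,\infty)$, $u\not\equiv-\infty$, let $\Delta u$ denote its distributional Laplacian, a positive Borel measure on $\Omega$ that is finite on compact sets, and for $z\in\Omega_\delta$ let $$\tilde u_{\delta/2}(z):=\frac1{\mathrm{Vol}(b\mathbb B(z,\frac\delta2))}\int_{b\mathbb B(z,\frac\delta2)}u(\zeta)\,dS(\zeta)$$ be the mean of $u$, with respect to surface measure, over the sphere of radius $\delta/2$ centered at $z$. Theorem 3.1. For every $\epsilon>0$ there is a constant $C>0$, depending only on $\Omega$, $r$ and $\epsilon$, such that for every plurisubharmonic function $u\not\equiv-\infty$ on $\Omega$ and every $\delta>0$ $$\|\tilde u_{\delta/2}-u\|_{L^1(\Omega_\delta)}\le C\,\delta^{1-\epsilon}\int_{\Omega_{\delta/2}}(-r)^{1+\epsilon}\,\Delta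 u .$$ The integral on the right is the total mass $\|(-r)^{1+\epsilon}\Delta u\|^{\Omega_{\delta/2}}$ of the positive measure $(-r)^{1+\epsilon}\Delta u$ on $\Omega_{\delta/2}$. -/

import Mathlib

open MeasureTheory
open scoped ENNReal ContDiff

noncomputable section

/-- The space `ℂⁿ` with its Euclidean norm (and the induced real Euclidean structure of `ℝ²ⁿ`,
which provides Lebesgue measure and the Laplacian). -/
abbrev Cn (n : ℕ) : Type := EuclideanSpace ℂ (Fin n)

/-- The integral `∫ f⁺ - ∫ f⁻` of an extended real valued function. It is the usual integral
with values in `[-∞, ∞)` whenever `f` is measurable and `∫ f⁺ < ∞`. -/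
def extIntegral {X : Type*} [MeasurableSpace X] (ν : Measure X) (f : X → EReal) : EReal :=
  ((∫⁻ x, (f x).toENNReal ∂ν : ℝ≥0∞) : EReal) - ((∫⁻ x, (-f x).toENNReal ∂ν : ℝ≥0∞) : EReal)

/-- The mean of `u` over the circle `{z + τ w : |τ| = 1}` of the complex line `z + ℂ w`. -/
def circleMean {n : ℕ} (u : Cn n → EReal) (z w : Cn n) : EReal :=
  extIntegral (volume.restrict (Set.Icc (0 : ℝ) 1))
    fun s => u (z + Complex.exp (2 * Real.pi * s * Complex.I) • w)

/-- Plurisubharmonic functions `u : Ω → [-∞, ∞)`: upper semicontinuous functions with the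
sub-mean value property on every closed disc, contained in `Ω`, of every complex line. -/
structure IsPlurisubharmonicOn {n : ℕ} (u : Cn n → EReal) (Ω : Set (Cn n)) : Prop where
  upperSemicontinuousOn : UpperSemicontinuousOn u Ω
  lt_top : ∀ z ∈ Ω, u z < ⊤
  le_circleMean : ∀ z ∈ Ω, ∀ w : Cn n,
    (∀ τ : ℂ, ‖τ‖ ≤ 1 → z + τ • w ∈ Ω) → u z ≤ circleMean u z w

/-- The measure `μ` is `Δu` on `Ω` in the sense of distributions: it is finite on the compact
subsets of `Ω` and `∫ u Δφ dV = ∫ φ dμ` for every test function `φ ∈ C_c^∞(Ω)`. (Functions `u`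
to which this is applied are plurisubharmonic and `≢ -∞`, hence locally integrable and finite
almost everywhere.) -/
structure IsLaplacianMeasure {n : ℕ} (u : Cn n → EReal) (Ω : Set (Cn n))
    (μ : Measure (Cn n)) : Prop where
  finite_on_compact : ∀ K : Set (Cn n), IsCompact K → K ⊆ Ω → μ K < ⊤
  integral_eq : ∀ φ : Cn n → ℝ, ContDiff ℝ ∞ φ → HasCompactSupport φ → tsupport φ ⊆ Ω →
    ∫ z, (u z).toReal * Laplacian.laplacian φ z = ∫ z, φ z ∂μ

/-- `r` is a smooth defining function of `Ω`. -/
def IsSmoothDefiningFunction {n : ℕ} (r : Cn n → ℝ) (Ω : Set (Cn n)) : Prop :=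
  ∃ U : Set (Cn n), IsOpen U ∧ closure Ω ⊆ U ∧ ContDiffOn ℝ ∞ r U ∧
    Ω = {z ∈ U | r z < 0} ∧ ∀ z ∈ frontier Ω, fderiv ℝ r z ≠ 0

/-- `Ω_δ`: the points of `Ω` at distance more than `δ` from the boundary. -/
def innerDomain {n : ℕ} (Ω : Set (Cn n)) (δ : ℝ) : Set (Cn n) :=
  {z ∈ Ω | δ < Metric.infDist z (frontier Ω)}

/-- The surface measure of the unit sphere of `ℂⁿ`, normalized to total mass `1`. -/
def unitSphereProb (n : ℕ) : Measure (Metric.sphere (0 : Cn n) 1) :=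
  ((volume : Measure (Cn n)).toSphere Set.univ)⁻¹ • (volume : Measure (Cn n)).toSphere

/-- The mean of `u`, with respect to surface measure, over the sphere of radius `ρ` about `z`. -/
def sphericalMean {n : ℕ} (u : Cn n → EReal) (ρ : ℝ) (z : Cn n) : EReal :=
  extIntegral (unitSphereProb n) fun ξ => u (z + ρ • (ξ : Cn n))

/-- The norm `‖f‖_{L¹(G)}` of an extended real valued function, for Lebesgue measure. -/
def L1Norm {n : ℕ} (f : Cn n → EReal) (G : Set (Cn n)) : ℝ≥0∞ :=
  ∫⁻ z in G, (f z).abs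

/-- The total mass on `G` of the measure `w μ` with density `w ≥ 0` with respect to `μ`. -/
def weightedMass {n : ℕ} (w : Cn n → ℝ) (μ : Measure (Cn n)) (G : Set (Cn n)) : ℝ≥0∞ :=
  ∫⁻ z in G, ENNReal.ofReal (w z) ∂μ

end

/-!
The mean of `u` over the sphere of radius `ρ = δ / 2` exceeds `u` by the Green potential
`∫ g_ρ(ζ - z) dμ(ζ)` of `μ = Δu` on the ball of radius `ρ` about `z` (the Riesz–Jensen formula).
The kernel `g_ρ` is nonnegative, is supported in that ball and has total integral `ρ² / (2N)`,
`N = 2n`. By Tonelli the `L¹` norm of the excess over `Ω_δ` is therefore at most `ρ² / (2N)` times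
the mass of `μ` on `Ω_{δ/2}`, which contains every such ball. There `-r` is at least a fixed
multiple of the distance to the boundary, hence of `δ`, so that `δ²` is at most a constant times
`δ^{1-ε} (-r)^{1+ε}`.

The Riesz–Jensen formula is needed only for almost every `z`, and
`ae_sphere_mean_sub_eq_greenPotential` obtains it by duality: for a test function `φ` the Green
potential `g_ρ ⋆ φ` is again a test function, whose Laplacian is the spherical mean of `φ` minus
`φ`. Inserting it into the definition of `Δu` and applying Fubini gives the formula integrated
against `φ`. For `φ` itself the formula is `integral_greenKernel_mul_laplacian`. Since `g_ρ` is
the integral over `s < ρ` of `s^{1-N}` times the indicator of the ball of radius `s`, up to the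
area of the unit sphere, it reduces to the equality of `∫_{B_s} Δφ` with the flux of `∇φ` through
the sphere of radius `s`, for almost every `s` (`ae_setIntegral_ball_laplacian`).

Plurisubharmonicity enters through `IsPlurisubharmonicOn.setLIntegral_neg_lt_top`, the local
integrability of `u⁻`; as `u` is locally bounded above, this makes all integrals meaningful. The nonvanishing of `dr` on the
boundary enters through `IsSmoothDefiningFunction.exists_mul_infDist_le`.
-/

/-! ### Calculus of smooth functions of compact support -/

section Calculus

variable {E : Type*} [NormedAddCommGroup E] [InnerProductSpace ℝ E]

theorem ContDiff.fderiv_apply_const {f : E → ℝ} (hf : ContDiff ℝ ∞ f) (v : E) :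
    ContDiff ℝ ∞ fun x => fderiv ℝ f x v :=
  (hf.fderiv_right (m := ∞) (by simp)).clm_apply contDiff_const

variable [FiniteDimensional ℝ E]

theorem laplacian_eq_sum_fderiv {f : E → ℝ} (hf : ContDiff ℝ ∞ f) (x : E) :
    Laplacian.laplacian f x = ∑ i, fderiv ℝ (fun y => fderiv ℝ f y (stdOrthonormalBasis ℝ E i)) x
      (stdOrthonormalBasis ℝ E i) := by
  have hf' : DifferentiableAt ℝ (fderiv ℝ f) x :=
    ((hf.fderiv_right (m := ∞) (by simp)).differentiable (by simp)) x
  rw [InnerProductSpace.laplacian_eq_iteratedFDeriv_stdOrthonormalBasis]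
  refine Finset.sum_congr rfl fun i _ => ?_
  rw [iteratedFDeriv_two_apply]
  rw [fderiv_clm_apply hf' (by fun_prop)]
  simp

theorem ContDiff.continuous_laplacian {f : E → ℝ} (hf : ContDiff ℝ ∞ f) :
    Continuous (Laplacian.laplacian f) := by
  rw [show Laplacian.laplacian f = _ from funext (laplacian_eq_sum_fderiv hf)]
  exact continuous_finsetSum _ fun i _ =>
    ((hf.fderiv_apply_const _).fderiv_apply_const _).continuous

theorem support_laplacian_subset {f : E → ℝ} (hf : ContDiff ℝ ∞ f) :
    Function.support (Laplacian.laplacian f) ⊆ tsupport f := by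
  intro x hx
  by_contra hx'
  apply hx
  rw [laplacian_eq_sum_fderiv hf]
  refine Finset.sum_eq_zero fun i _ => ?_
  have : (fun y => fderiv ℝ f y (stdOrthonormalBasis ℝ E i)) =ᶠ[nhds x] fun _ => (0 : ℝ) := by
    filter_upwards [(isClosed_tsupport f).isOpen_compl.mem_nhds hx'] with y hy
    rw [fderiv_of_notMem_tsupport (𝕜 := ℝ) hy]; simp
  rw [this.fderiv_eq]; simp

theorem HasCompactSupport.laplacian {f : E → ℝ} (hf : ContDiff ℝ ∞ f)
    (hc : HasCompactSupport f) : HasCompactSupport (Laplacian.laplacian f) :=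
  HasCompactSupport.of_support_subset_isCompact hc (support_laplacian_subset hf)

theorem laplacian_comp_sub {f : E → ℝ} (hf : ContDiff ℝ ∞ f) (a x : E) :
    Laplacian.laplacian (fun y => f (a - y)) x = Laplacian.laplacian f (a - x) := by
  have h1 : ∀ (g : E → ℝ), ContDiff ℝ ∞ g → ∀ y v : E,
      fderiv ℝ (fun y => g (a - y)) y v = - fderiv ℝ g (a - y) v := by
    intro g hg y v
    have := (hg.differentiable (by simp) (a - y)).hasFDerivAt.comp y
      ((hasFDerivAt_id y).const_sub a)
    have h2 := this.fderiv
    simp only [Function.comp_def] at h2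
    rw [h2]; simp
  rw [laplacian_eq_sum_fderiv hf, laplacian_eq_sum_fderiv (f := fun y => f (a - y))
    (hf.comp (contDiff_const.sub contDiff_id))]
  refine Finset.sum_congr rfl fun i _ => ?_
  simp_rw [h1 f hf]
  rw [fderiv_fun_neg, neg_apply, h1 _ (hf.fderiv_apply_const _), neg_neg]

variable [MeasurableSpace E] [BorelSpace E]

open scoped Convolution in
/-- The Laplacian of a convolution falls on the smooth factor. -/
theorem laplacian_convolution {g φ : E → ℝ} (hg : LocallyIntegrable g)
    (hφ : ContDiff ℝ ∞ φ) (hc : HasCompactSupport φ) (x : E) :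
    Laplacian.laplacian (g ⋆[ContinuousLinearMap.mul ℝ ℝ] φ) x =
      (g ⋆[ContinuousLinearMap.mul ℝ ℝ] Laplacian.laplacian φ) x := by
  have key : ∀ (f : E → ℝ), ContDiff ℝ ∞ f → HasCompactSupport f → ∀ (v y : E),
      fderiv ℝ (g ⋆[ContinuousLinearMap.mul ℝ ℝ] f) y v =
        (g ⋆[ContinuousLinearMap.mul ℝ ℝ] fun a => fderiv ℝ f a v) y := by
    intro f hf hcf v y
    rw [(hcf.hasFDerivAt_convolution_right _ hg (hf.of_le (by simp)) y).fderiv]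
    exact convolution_precompR_apply _ hg (hcf.fderiv ℝ) (hf.continuous_fderiv (by simp)) y v
  have hsm : ContDiff ℝ ∞ (g ⋆[ContinuousLinearMap.mul ℝ ℝ] φ) :=
    hc.contDiff_convolution_right (n := ⊤) _ hg hφ
  rw [laplacian_eq_sum_fderiv hsm]
  have h1 : ∀ v : E, HasCompactSupport fun a => fderiv ℝ φ a v := fun v => hc.fderiv_apply ℝ v
  simp_rw [key φ hφ hc, key _ (hφ.fderiv_apply_const _) (h1 _)]
  rw [show Laplacian.laplacian φ = _ from funext (laplacian_eq_sum_fderiv hφ)]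
  simp only [convolution_def, ContinuousLinearMap.mul_apply', Finset.mul_sum]
  rw [integral_finsetSum]
  intro i _
  have := (HasCompactSupport.fderiv_apply ℝ (h1 (stdOrthonormalBasis ℝ E i))
    (stdOrthonormalBasis ℝ E i)).convolutionExists_right (ContinuousLinearMap.mul ℝ ℝ) hg
    ((hφ.fderiv_apply_const _).fderiv_apply_const _).continuous x
  exact this

/-- Green's first identity on the whole space: integration by parts of the Laplacian against a
`C¹` function of compact support. -/
theorem integral_mul_laplacian {h φ : E → ℝ} (hh : ContDiff ℝ 1 h) (hch : HasCompactSupport h)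
    (hφ : ContDiff ℝ ∞ φ) :
    ∫ x, h x * Laplacian.laplacian φ x = - ∫ x, ∑ i,
      fderiv ℝ h x (stdOrthonormalBasis ℝ E i) * fderiv ℝ φ x (stdOrthonormalBasis ℝ E i) := by
  have hc1 : ∀ v, Continuous fun x => fderiv ℝ h x v :=
    fun v => (hh.continuous_fderiv (by simp)).clm_apply continuous_const
  have hi1 : ∀ v, Integrable fun x => fderiv ℝ h x v * fderiv ℝ φ x v := fun v =>
    ((hc1 v).mul (hφ.fderiv_apply_const v).continuous).integrable_of_hasCompactSupport
      ((hch.fderiv_apply ℝ v).mul_right)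
  have hi2 : ∀ v, Integrable fun x => h x * fderiv ℝ (fun y => fderiv ℝ φ y v) x v := fun v =>
    (hh.continuous.mul
      ((hφ.fderiv_apply_const v).fderiv_apply_const v).continuous).integrable_of_hasCompactSupport
        hch.mul_right
  simp_rw [laplacian_eq_sum_fderiv hφ, Finset.mul_sum]
  rw [integral_finsetSum _ fun i _ => hi2 _, integral_finsetSum _ fun i _ => hi1 _,
    ← Finset.sum_neg_distrib]
  refine Finset.sum_congr rfl fun i _ => ?_
  refine integral_mul_fderiv_eq_neg_fderiv_mul_of_integrable (hi1 _) (hi2 _) ?_ ?_ ?_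
  · exact (hh.continuous.mul (hφ.fderiv_apply_const _).continuous).integrable_of_hasCompactSupport
      hch.mul_right
  · exact fun x _ => hh.differentiable (by simp) x
  · exact fun x _ => (hφ.fderiv_apply_const _).differentiable (by simp) x

end Calculus

/-! ### Polar coordinates -/

section Polar

variable {E : Type*} [NormedAddCommGroup E] [NormedSpace ℝ E] [FiniteDimensional ℝ E]
  [MeasurableSpace E] [BorelSpace E] [Nontrivial E]

/-- Integration in polar coordinates. -/
theorem integral_eq_integral_Ioi_sphere (μ : Measure E) [μ.IsAddHaarMeasure] {F : E → ℝ}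
    (hF : Integrable F μ) :
    ∫ x, F x ∂μ = ∫ t in Set.Ioi (0 : ℝ), t ^ (Module.finrank ℝ E - 1) *
      ∫ ξ : Metric.sphere (0 : E) 1, F (t • (ξ : E)) ∂μ.toSphere := by
  have hmp := μ.measurePreserving_homeomorphUnitSphereProd
  have hemb := (homeomorphUnitSphereProd E).measurableEmbedding
  let G : Metric.sphere (0 : E) 1 × Set.Ioi (0 : ℝ) → ℝ := fun p => F ((p.2 : ℝ) • (p.1 : E))
  have hG : ∀ x, G (homeomorphUnitSphereProd E x) = F x := by
    intro x
    simp only [G]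
    congr 1
    have hx : ‖(x : E)‖ ≠ 0 := norm_ne_zero_iff.2 x.2
    simp [smul_smul, hx]
  have hs : MeasurableSet ({0}ᶜ : Set E) := (measurableSet_singleton _).compl
  have hGi : Integrable G (μ.toSphere.prod (.volumeIoiPow (Module.finrank ℝ E - 1))) := by
    rw [← hmp.integrable_comp_emb hemb]
    simp only [Function.comp_def, hG]
    exact (integrableOn_iff_comap_subtypeVal hs).1 hF.integrableOn
  calc ∫ x, F x ∂μ = ∫ x : ({(0)}ᶜ : Set E), F x ∂(μ.comap (↑)) := by
        rw [integral_subtype_comap hs F, restrict_compl_singleton]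
    _ = ∫ p, G p ∂μ.toSphere.prod (.volumeIoiPow (Module.finrank ℝ E - 1)) := by
        rw [← hmp.integral_comp hemb]; simp only [hG]
    _ = ∫ t : Set.Ioi (0 : ℝ), ∫ ξ, G (ξ, t) ∂μ.toSphere
          ∂(.volumeIoiPow (Module.finrank ℝ E - 1)) := integral_prod_symm _ hGi
    _ = _ := by
        simp only [Measure.volumeIoiPow, ENNReal.ofReal]
        rw [integral_withDensity_eq_integral_smul
          (measurable_subtype_coe.pow_const _).real_toNNReal]
        rw [integral_subtype_comap measurableSet_Ioi fun a : ℝ =>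
          Real.toNNReal (a ^ (Module.finrank ℝ E - 1)) • ∫ ξ, F (a • (ξ : E)) ∂μ.toSphere]
        refine setIntegral_congr_fun measurableSet_Ioi fun x hx => ?_
        simp only [NNReal.smul_def, smul_eq_mul]
        rw [Real.coe_toNNReal _ (pow_nonneg hx.out.le _)]

end Polar

/-! ### The flux of the gradient through spheres -/

section Flux

/-- The tail primitive `t ↦ ∫_t^∞ ψ` of a continuous integrable function is `C¹`. -/
theorem hasDerivAt_integral_Ioi {ψ : ℝ → ℝ} (hψ : Continuous ψ) (hi : Integrable ψ) (t : ℝ) :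
    HasDerivAt (fun t => ∫ s in Set.Ioi t, ψ s) (-ψ t) t := by
  have h : (fun t => ∫ s in Set.Ioi t, ψ s) =
      fun t => (∫ s in Set.Ioi 0, ψ s) - ∫ s in (0 : ℝ)..t, ψ s := by
    ext t
    rw [eq_sub_iff_add_eq', intervalIntegral.integral_interval_add_Ioi hi.integrableOn
      hi.integrableOn]
  rw [h]
  simpa using (hψ.integral_hasStrictDerivAt 0 t).hasDerivAt.const_sub (∫ s in Set.Ioi 0, ψ s)

variable {E : Type*} [NormedAddCommGroup E] [InnerProductSpace ℝ E]

/-- A tail primitive of a test function on `(0, ∞)`, composed with the norm. -/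
theorem contDiff_integral_Ioi_norm {ψ : ℝ → ℝ} (hψ : ContDiff ℝ ∞ ψ) (hc : HasCompactSupport ψ)
    (hs : tsupport ψ ⊆ Set.Ioi 0) :
    ContDiff ℝ 1 fun x : E => ∫ s in Set.Ioi ‖x‖, ψ s := by
  have hi : Integrable ψ := hψ.continuous.integrable_of_hasCompactSupport hc
  have hd := hasDerivAt_integral_Ioi hψ.continuous hi
  have hK : ContDiff ℝ 1 fun t => ∫ s in Set.Ioi t, ψ s := by
    rw [contDiff_one_iff_deriv]
    refine ⟨fun t => (hd t).differentiableAt, ?_⟩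
    rw [funext fun t => (hd t).deriv]
    exact hψ.continuous.neg
  rw [contDiff_iff_contDiffAt]
  intro x
  rcases eq_or_ne x 0 with rfl | hx
  · -- near the origin the function is constant, because `ψ` vanishes near `0`
    have h0 : (0 : ℝ) ∉ tsupport ψ := fun h => lt_irrefl (0 : ℝ) (hs h)
    obtain ⟨a, ha, hball⟩ := Metric.isOpen_iff.1 (isClosed_tsupport ψ).isOpen_compl 0 h0
    have : (fun x : E => ∫ s in Set.Ioi ‖x‖, ψ s) =ᶠ[nhds 0] fun _ => ∫ s in Set.Ioi 0, ψ s := by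
      filter_upwards [Metric.ball_mem_nhds (0 : E) ha] with y hy
      rw [← intervalIntegral.integral_interval_add_Ioi (a := 0) (b := ‖y‖) hi.integrableOn
        hi.integrableOn, intervalIntegral.integral_of_le (norm_nonneg _),
        right_eq_add]
      refine setIntegral_eq_zero_of_forall_eq_zero fun s hs' => ?_
      refine image_eq_zero_of_notMem_tsupport (hball ?_)
      have : ‖y‖ < a := by simpa using hy
      simpa [abs_of_pos hs'.1] using hs'.2.trans_lt this
    exact contDiffAt_const.congr_of_eventuallyEq this
  · exact hK.contDiffAt.comp x (contDiffAt_norm ℝ hx)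

theorem fderiv_integral_Ioi_norm {ψ : ℝ → ℝ} (hψ : Continuous ψ) (hi : Integrable ψ)
    {x : E} (hx : x ≠ 0) (v : E) :
    fderiv ℝ (fun x : E => ∫ s in Set.Ioi ‖x‖, ψ s) x v = -(ψ ‖x‖ * (inner ℝ x v / ‖x‖)) := by
  have h1 : HasFDerivAt (fun x : E => ‖x‖) (fderiv ℝ (fun x : E => ‖x‖) x) x :=
    ((contDiffAt_norm ℝ hx (n := 1)).differentiableAt (by simp)).hasFDerivAt
  have h2 := (hasDerivAt_integral_Ioi hψ hi ‖x‖).comp_hasFDerivAt x h1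
  have h3 : fderiv ℝ (fun x : E => ‖x‖) x v = inner ℝ x v / ‖x‖ := by
    have h4 : HasFDerivAt (fun x : E => ‖x‖ ^ 2) (2 • innerSL ℝ x) x :=
      (hasStrictFDerivAt_norm_sq x).hasFDerivAt
    have h5 := h4.unique (h1.pow 2)
    have h6 := congrArg (fun L : E →L[ℝ] ℝ => L v) h5
    have hn : ‖x‖ ≠ 0 := norm_ne_zero_iff.2 hx
    simp at h6
    rw [eq_div_iff hn]
    linarith
  have h7 := h2.fderiv
  simp only [Function.comp_def] at h7
  rw [h7]
  simp [h3]

variable [FiniteDimensional ℝ E] [MeasurableSpace E] [BorelSpace E] [Nontrivial E]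

/-- The divergence theorem for `∇φ` on almost every ball about the origin: the integral of `Δφ`
over the ball is the flux of `∇φ` through the sphere. It is obtained by testing the identity, as
an equality of functions of the radius, against `ψ ∈ C_c^∞(0, ∞)`; in that form it is an
integration by parts against a radial function. -/
theorem ae_setIntegral_ball_laplacian {φ : E → ℝ} (hφ : ContDiff ℝ ∞ φ)
    (hc : HasCompactSupport φ) :
    ∀ᵐ s : ℝ, s ∈ Set.Ioi (0 : ℝ) → ∫ x in Metric.ball (0 : E) s, Laplacian.laplacian φ x =
      s ^ (Module.finrank ℝ E - 1) * ∫ ξ : Metric.sphere (0 : E) 1,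
        fderiv ℝ φ (s • (ξ : E)) ξ ∂(volume : Measure E).toSphere := by
  set σ := (volume : Measure E).toSphere with hσ
  set N := Module.finrank ℝ E - 1 with hN
  set F := Laplacian.laplacian φ with hF
  have hFc : Continuous F := hφ.continuous_laplacian
  have hFi : Integrable F := hFc.integrable_of_hasCompactSupport (hc.laplacian hφ)
  set A : ℝ → ℝ := fun s => ∫ x in Metric.ball (0 : E) s, F x with hA
  set D : ℝ → ℝ := fun s => s ^ N * ∫ ξ : Metric.sphere (0 : E) 1, fderiv ℝ φ (s • (ξ : E)) ξ ∂σ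
    with hD
  let T : Set (ℝ × E) := {p | ‖p.2‖ < p.1}
  have hT : MeasurableSet T := (isOpen_lt (by fun_prop) (by fun_prop)).measurableSet
  have hAT : ∀ s x, (Metric.ball (0 : E) s).indicator F x
      = T.indicator (fun p : ℝ × E => F p.2) (s, x) := by
    intro s x
    simp [Set.indicator, T]
  have hAm : StronglyMeasurable A := by
    have : A = fun s => ∫ x, T.indicator (fun p : ℝ × E => F p.2) (s, x) := by
      ext s
      simp only [hA, ← hAT]
      rw [integral_indicator Metric.isOpen_ball.measurableSet]
    rw [this]
    exact StronglyMeasurable.integral_prod_right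
      (f := fun s x => T.indicator (fun p : ℝ × E => F p.2) (s, x))
      ((hFc.comp continuous_snd).stronglyMeasurable.indicator hT)
  have hAb : ∀ s, ‖A s‖ ≤ ∫ x, ‖F x‖ := fun s =>
    (norm_integral_le_integral_norm _).trans
      (setIntegral_le_integral hFi.norm (Filter.Eventually.of_forall fun _ => norm_nonneg _))
  have hAl : LocallyIntegrable A :=
    (locallyIntegrable_const (∫ x, ‖F x‖)).mono hAm.aestronglyMeasurable
      (Filter.Eventually.of_forall fun s => (hAb s).trans (le_abs_self _))
  have hφ' : Continuous (fderiv ℝ φ) := hφ.continuous_fderiv (by simp)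
  have hDc : Continuous D := by
    refine (continuous_id.pow N).mul ?_
    obtain ⟨C, hC⟩ := (hc.fderiv ℝ).exists_bound_of_continuous hφ'
    refine continuous_of_dominated (bound := fun _ => C) (fun s => ?_) (fun s => ?_)
      (integrable_const _) ?_
    · exact Continuous.aestronglyMeasurable (by fun_prop)
    · refine Filter.Eventually.of_forall fun ξ => ?_
      refine (ContinuousLinearMap.le_opNorm _ _).trans ?_
      simpa using hC _
    · exact Filter.Eventually.of_forall fun ξ => by fun_prop
  suffices h : ∀ᵐ s : ℝ, s ∈ Set.Ioi (0 : ℝ) → A s - D s = 0 by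
    filter_upwards [h] with s hs h0 using sub_eq_zero.1 (hs h0)
  refine isOpen_Ioi.ae_eq_zero_of_integral_contDiff_smul_eq_zero
    ((hAl.sub hDc.locallyIntegrable).locallyIntegrableOn _) fun ψ hψ hψc hψs => ?_
  have hψi : Integrable ψ := hψ.continuous.integrable_of_hasCompactSupport hψc
  simp only [smul_sub]
  rw [integral_sub (hAl.integrable_smul_left_of_hasCompactSupport hψ.continuous hψc)
    (hDc.locallyIntegrable.integrable_smul_left_of_hasCompactSupport hψ.continuous hψc),
    sub_eq_zero]
  let h : E → ℝ := fun x => ∫ s in Set.Ioi ‖x‖, ψ s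
  have hh : ContDiff ℝ 1 h := contDiff_integral_Ioi_norm hψ hψc hψs
  have hhc : HasCompactSupport h := by
    obtain ⟨R, hR⟩ := hψc.isBounded.subset_closedBall (0 : ℝ)
    refine HasCompactSupport.of_support_subset_isCompact (isCompact_closedBall (0 : E) R) ?_
    intro x hx
    by_contra hx'
    have hx'' : R < ‖x‖ := by simpa using hx'
    refine hx (setIntegral_eq_zero_of_forall_eq_zero fun s hs => ?_)
    refine image_eq_zero_of_notMem_tsupport fun hs' => ?_
    have := hR hs'
    simp only [Metric.mem_closedBall, dist_zero_right, Real.norm_eq_abs] at this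
    exact absurd ((le_abs_self s).trans this) (not_le.2 (hx''.trans hs))
  have hpt : ∀ᵐ x : E, -∑ i, fderiv ℝ h x (stdOrthonormalBasis ℝ E i) *
      fderiv ℝ φ x (stdOrthonormalBasis ℝ E i) = ψ ‖x‖ * fderiv ℝ φ x (‖x‖⁻¹ • x) := by
    have h0 : ∀ᵐ x : E, x ≠ 0 := by
      simp [ae_iff]
    filter_upwards [h0] with x hx
    simp only [h, fderiv_integral_Ioi_norm hψ.continuous hψi hx]
    have hsum : fderiv ℝ φ x x = ∑ i, inner ℝ x (stdOrthonormalBasis ℝ E i) *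
        fderiv ℝ φ x (stdOrthonormalBasis ℝ E i) := by
      have := congrArg (fderiv ℝ φ x) ((stdOrthonormalBasis ℝ E).sum_repr' x)
      rw [map_sum] at this
      rw [← this]
      simp [real_inner_comm]
    rw [map_smul, hsum, smul_eq_mul, Finset.mul_sum, Finset.mul_sum, ← Finset.sum_neg_distrib]
    exact Finset.sum_congr rfl fun i _ => by ring
  calc ∫ s, ψ s • A s = ∫ s, ∫ x, T.indicator (fun p : ℝ × E => ψ p.1 * F p.2) (s, x) := by
        refine integral_congr_ae (Filter.Eventually.of_forall fun s => ?_)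
        simp only [hA, smul_eq_mul]
        rw [← integral_indicator Metric.isOpen_ball.measurableSet, ← integral_const_mul]
        refine integral_congr_ae (Filter.Eventually.of_forall fun x => ?_)
        simp only [hAT]
        by_cases hx : (s, x) ∈ T <;> simp [hx]
    _ = ∫ x, ∫ s, T.indicator (fun p : ℝ × E => ψ p.1 * F p.2) (s, x) :=
        integral_integral_swap ((hψi.mul_prod hFi).indicator hT)
    _ = ∫ x, h x * F x := by
        refine integral_congr_ae (Filter.Eventually.of_forall fun x => ?_)
        simp only [h]
        rw [← integral_mul_const, ← integral_indicator measurableSet_Ioi]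
        refine integral_congr_ae (Filter.Eventually.of_forall fun s => ?_)
        simp [Set.indicator, T]
    _ = ∫ x, ψ ‖x‖ * fderiv ℝ φ x (‖x‖⁻¹ • x) := by
        rw [hF, integral_mul_laplacian hh hhc hφ, ← integral_neg]
        exact integral_congr_ae hpt
    _ = ∫ t in Set.Ioi (0 : ℝ), t ^ N * ∫ ξ : Metric.sphere (0 : E) 1,
          ψ ‖t • (ξ : E)‖ * fderiv ℝ φ (t • (ξ : E)) (‖t • (ξ : E)‖⁻¹ • t • (ξ : E)) ∂σ := by
        refine integral_eq_integral_Ioi_sphere volume ?_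
        refine Integrable.congr ?_ hpt
        refine (integrable_finsetSum _ fun i _ => ?_).neg
        exact (((hh.continuous_fderiv (by simp)).clm_apply continuous_const).mul
          (hφ.fderiv_apply_const _).continuous).integrable_of_hasCompactSupport
            ((hhc.fderiv_apply ℝ _).mul_right)
    _ = ∫ t in Set.Ioi (0 : ℝ), ψ t • D t := by
        refine setIntegral_congr_fun measurableSet_Ioi fun t ht => ?_
        have ht' : (0 : ℝ) < t := ht
        simp only [hD, smul_eq_mul]
        rw [mul_left_comm, ← integral_const_mul (ψ t)]
        congr 1
        refine integral_congr_ae (Filter.Eventually.of_forall fun ξ => ?_)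
        simp [norm_smul, abs_of_pos ht', smul_smul, ht'.ne']
    _ = ∫ t, ψ t • D t := by
        refine setIntegral_eq_integral_of_forall_compl_eq_zero fun t ht => ?_
        rw [image_eq_zero_of_notMem_tsupport fun h' => ht (hψs h'), zero_smul]

end Flux

/-! ### The Green kernel of the ball -/

section Kernel

variable {E : Type*} [NormedAddCommGroup E] [InnerProductSpace ℝ E]

/-- The integrand `s^{1-N} 1_{‖x‖ < s}` of the Green kernel, `N` being the dimension. -/
noncomputable def greenIntegrand (s : ℝ) (x : E) : ℝ :=
  {p : ℝ × E | ‖p.2‖ < p.1}.indicator (fun p => (p.1 ^ (Module.finrank ℝ E - 1))⁻¹) (s, x)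

theorem greenIntegrand_nonneg {s : ℝ} (hs : 0 ≤ s) (x : E) : 0 ≤ greenIntegrand s x :=
  Set.indicator_apply_nonneg fun _ => inv_nonneg.2 (pow_nonneg hs _)

theorem greenIntegrand_eq_indicator (s : ℝ) :
    (greenIntegrand s : E → ℝ) = (Metric.ball (0 : E) s).indicator
      fun _ => (s ^ (Module.finrank ℝ E - 1))⁻¹ := by
  ext x
  simp [greenIntegrand, Set.indicator]

variable [FiniteDimensional ℝ E] [MeasurableSpace E] [BorelSpace E]

/-- The Green kernel, with pole at the origin, of the ball of radius `ρ` in dimension `N`: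
`|S|⁻¹ ∫_{‖x‖}^ρ s^{1-N} ds` for `‖x‖ < ρ` and `0` elsewhere, `|S|` being the area of the unit
sphere. Writing it as an integral covers the power and the logarithm at once; its value at the
pole is irrelevant. -/
noncomputable def greenKernel (ρ : ℝ) (x : E) : ℝ :=
  ((volume : Measure E).toSphere.real Set.univ)⁻¹ * ∫ s in Set.Ioo 0 ρ, greenIntegrand s x

theorem measurable_greenIntegrand : Measurable fun p : ℝ × E => greenIntegrand p.1 p.2 :=
  Measurable.indicator (by fun_prop) (isOpen_lt (by fun_prop) (by fun_prop)).measurableSet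

theorem measurable_greenKernel (ρ : ℝ) : Measurable (greenKernel ρ : E → ℝ) := by
  refine Measurable.const_mul ?_ _
  exact (StronglyMeasurable.integral_prod_right
    (f := fun (x : E) s => greenIntegrand s x) (ν := volume.restrict (Set.Ioo 0 ρ))
    (measurable_greenIntegrand.comp measurable_swap).stronglyMeasurable).measurable

theorem greenKernel_nonneg (ρ : ℝ) (x : E) : 0 ≤ greenKernel ρ x :=
  mul_nonneg (by positivity) (setIntegral_nonneg measurableSet_Ioo fun _ hs =>
    greenIntegrand_nonneg hs.1.le x)

theorem greenKernel_eq_zero {ρ : ℝ} {x : E} (hx : ρ ≤ ‖x‖) : greenKernel ρ x = 0 := by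
  rw [greenKernel, setIntegral_eq_zero_of_forall_eq_zero, mul_zero]
  intro s hs
  refine Set.indicator_of_notMem ?_ _
  simpa using hs.2.le.trans hx

variable [Nontrivial E]

theorem toSphere_real_univ_pos : 0 < (volume : Measure E).toSphere.real Set.univ := by
  rw [Measure.toSphere_real_apply_univ]
  have : 0 < Module.finrank ℝ E := Module.finrank_pos
  have : 0 < (volume : Measure E).real (Metric.ball 0 1) :=
    ENNReal.toReal_pos (Metric.measure_ball_pos _ _ one_pos).ne' measure_ball_lt_top.ne
  positivity

theorem integral_greenIntegrand {s : ℝ} (hs : 0 < s) :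
    ∫ x : E, greenIntegrand s x = s * (volume : Measure E).real (Metric.ball 0 1) := by
  rw [greenIntegrand_eq_indicator, integral_indicator Metric.isOpen_ball.measurableSet,
    setIntegral_const, smul_eq_mul, measureReal_def, Measure.addHaar_ball _ _ hs.le,
    ENNReal.toReal_mul, ENNReal.toReal_ofReal (by positivity), measureReal_def]
  obtain ⟨k, hk⟩ : ∃ k, Module.finrank ℝ E = k + 1 :=
    Nat.exists_eq_succ_of_ne_zero (Module.finrank_pos (R := ℝ) (M := E)).ne'
  rw [hk, Nat.add_sub_cancel, pow_succ]
  field_simp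

theorem integrable_greenIntegrand (ρ : ℝ) :
    Integrable (fun p : ℝ × E => greenIntegrand p.1 p.2)
      ((volume.restrict (Set.Ioo 0 ρ)).prod volume) := by
  rw [integrable_prod_iff measurable_greenIntegrand.aestronglyMeasurable]
  constructor
  · refine Filter.Eventually.of_forall fun s => ?_
    simp only [greenIntegrand_eq_indicator]
    rw [integrable_indicator_iff Metric.isOpen_ball.measurableSet]
    exact integrableOn_const measure_ball_lt_top.ne
  · have : IntegrableOn (fun s : ℝ => s * (volume : Measure E).real (Metric.ball 0 1))
        (Set.Ioo 0 ρ) :=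
      (Continuous.integrableOn_Icc (by fun_prop)).mono_set Set.Ioo_subset_Icc_self
    refine this.congr_fun (fun s hs => ?_) measurableSet_Ioo
    simp only [← integral_greenIntegrand hs.1]
    refine integral_congr_ae (Filter.Eventually.of_forall fun x => ?_)
    exact (Real.norm_of_nonneg (greenIntegrand_nonneg hs.1.le x)).symm

theorem integrable_greenKernel (ρ : ℝ) : Integrable (greenKernel ρ : E → ℝ) :=
  (integrable_greenIntegrand ρ).integral_prod_right.const_mul _

theorem integral_greenKernel_mul {ρ : ℝ} {F : E → ℝ} (hF : Continuous F) {C : ℝ}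
    (hC : ∀ x, ‖F x‖ ≤ C) :
    ∫ x, greenKernel ρ x * F x = ((volume : Measure E).toSphere.real Set.univ)⁻¹ *
      ∫ s in Set.Ioo 0 ρ, (s ^ (Module.finrank ℝ E - 1))⁻¹ * ∫ x in Metric.ball (0 : E) s, F x := by
  have hi : Integrable (fun p : ℝ × E => greenIntegrand p.1 p.2 * F p.2)
      ((volume.restrict (Set.Ioo 0 ρ)).prod volume) :=
    (integrable_greenIntegrand ρ).mul_bdd (hF.comp continuous_snd).aestronglyMeasurable
      (Filter.Eventually.of_forall fun p => hC p.2)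
  simp only [greenKernel, mul_assoc]
  rw [integral_const_mul]
  congr 1
  simp only [← integral_mul_const]
  rw [← integral_integral_swap (f := fun s x => greenIntegrand s x * F x) hi]
  refine integral_congr_ae (Filter.Eventually.of_forall fun s => ?_)
  simp only [greenIntegrand_eq_indicator]
  rw [← integral_const_mul, ← integral_indicator Metric.isOpen_ball.measurableSet]
  refine integral_congr_ae (Filter.Eventually.of_forall fun x => ?_)
  by_cases hx : x ∈ Metric.ball (0 : E) s <;> simp [hx]

theorem integral_greenKernel {ρ : ℝ} (hρ : 0 ≤ ρ) :
    ∫ x : E, greenKernel ρ x = ρ ^ 2 / (2 * Module.finrank ℝ E) := by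
  have h := integral_greenKernel_mul (E := E) (ρ := ρ) (F := fun _ => 1) continuous_const
    (C := 1) (by simp)
  simp only [mul_one] at h
  have hb : 0 < (volume : Measure E).real (Metric.ball 0 1) :=
    ENNReal.toReal_pos (Metric.measure_ball_pos _ _ one_pos).ne' measure_ball_lt_top.ne
  have hN : 0 < (Module.finrank ℝ E : ℝ) := by exact_mod_cast Module.finrank_pos
  have h2 : ∀ s ∈ Set.Ioo 0 ρ, (s ^ (Module.finrank ℝ E - 1))⁻¹ *
      ∫ x in Metric.ball (0 : E) s, (1 : ℝ) = s * (volume : Measure E).real (Metric.ball 0 1) := by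
    intro s hs
    rw [← integral_greenIntegrand hs.1, greenIntegrand_eq_indicator,
      integral_indicator Metric.isOpen_ball.measurableSet, setIntegral_const, setIntegral_const]
    simp [mul_comm]
  rw [h, setIntegral_congr_fun measurableSet_Ioo h2, integral_mul_const,
    ← integral_Ioc_eq_integral_Ioo,
    ← intervalIntegral.integral_of_le hρ, integral_id, Measure.toSphere_real_apply_univ]
  simp
  field_simp

/-- The Riesz–Jensen formula for test functions: integrating `Δφ` against the Green kernel gives
the excess of the mean over the sphere of radius `ρ` over the value at the centre. -/
theorem integral_greenKernel_mul_laplacian {ρ : ℝ} (hρ : 0 ≤ ρ) {φ : E → ℝ} (hφ : ContDiff ℝ ∞ φ)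
    (hc : HasCompactSupport φ) :
    ∫ x, greenKernel ρ x * Laplacian.laplacian φ x =
      ((volume : Measure E).toSphere.real Set.univ)⁻¹ *
        ∫ ξ : Metric.sphere (0 : E) 1, φ (ρ • (ξ : E)) ∂(volume : Measure E).toSphere - φ 0 := by
  have hFc := hφ.continuous_laplacian
  obtain ⟨C, hC⟩ := (hc.laplacian hφ).exists_bound_of_continuous hFc
  have hφ' : Continuous (fderiv ℝ φ) := hφ.continuous_fderiv (by simp)
  obtain ⟨C', hC'⟩ := (hc.fderiv ℝ).exists_bound_of_continuous hφ'
  rw [integral_greenKernel_mul hFc hC]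
  set σ := (volume : Measure E).toSphere
  have h1 : ∫ s in Set.Ioo 0 ρ, (s ^ (Module.finrank ℝ E - 1))⁻¹ *
        ∫ x in Metric.ball (0 : E) s, Laplacian.laplacian φ x =
      ∫ s in Set.Ioo 0 ρ, ∫ ξ : Metric.sphere (0 : E) 1, fderiv ℝ φ (s • (ξ : E)) ξ ∂σ := by
    refine setIntegral_congr_ae measurableSet_Ioo ?_
    filter_upwards [ae_setIntegral_ball_laplacian hφ hc] with s hs hs'
    have : s ^ (Module.finrank ℝ E - 1) ≠ 0 := pow_ne_zero _ hs'.1.ne'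
    rw [hs hs'.1, inv_mul_cancel_left₀ this]
  have h2 : Integrable (fun p : ℝ × Metric.sphere (0 : E) 1 =>
      fderiv ℝ φ (p.1 • (p.2 : E)) p.2) ((volume.restrict (Set.Ioo 0 ρ)).prod σ) := by
    refine Integrable.of_bound (C := C') (Continuous.aestronglyMeasurable (by fun_prop)) ?_
    refine Filter.Eventually.of_forall fun p => ?_
    refine (ContinuousLinearMap.le_opNorm _ _).trans ?_
    simpa using hC' _
  have h3 : ∀ ξ : Metric.sphere (0 : E) 1, ∫ s in Set.Ioo 0 ρ, fderiv ℝ φ (s • (ξ : E)) ξ =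
      φ (ρ • (ξ : E)) - φ 0 := by
    intro ξ
    rw [← integral_Ioc_eq_integral_Ioo, ← intervalIntegral.integral_of_le hρ]
    rw [intervalIntegral.integral_eq_sub_of_hasDerivAt (f := fun s : ℝ => φ (s • (ξ : E)))]
    · simp
    · intro s _
      have := ((hφ.differentiable (by simp) (s • (ξ : E))).hasFDerivAt).comp_hasDerivAt s
        ((hasDerivAt_id s).smul_const (ξ : E))
      simpa [Function.comp_def] using this
    · exact Continuous.intervalIntegrable (by fun_prop) _ _
  have h4 : Integrable (fun ξ : Metric.sphere (0 : E) 1 => φ (ρ • (ξ : E))) σ :=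
    Continuous.integrable_of_hasCompactSupport
      (hφ.continuous.comp (by fun_prop)) (HasCompactSupport.of_compactSpace _)
  rw [h1, integral_integral_swap h2]
  simp only [h3]
  rw [integral_sub h4 (integrable_const _), mul_sub, integral_const, smul_eq_mul,
    inv_mul_cancel_left₀ toSphere_real_univ_pos.ne']

end Kernel

/-! ### The Riesz–Jensen formula for distributional Laplacians -/

section RieszJensen

variable {E : Type*} [NormedAddCommGroup E] [InnerProductSpace ℝ E] [FiniteDimensional ℝ E]
  [MeasurableSpace E] [BorelSpace E]

theorem measurePreserving_sphere_translate (ρ : ℝ) :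
    MeasurePreserving (fun p : Metric.sphere (0 : E) 1 × E => (p.1, p.2 + ρ • (p.1 : E)))
      ((volume : Measure E).toSphere.prod volume) ((volume : Measure E).toSphere.prod volume) :=
  (MeasurePreserving.id _).skew_product
    (g := fun (ξ : Metric.sphere (0 : E) 1) x => x + ρ • (ξ : E)) (by fun_prop)
    (Filter.Eventually.of_forall fun ξ =>
      (measurePreserving_add_right (volume : Measure E) (ρ • (ξ : E))).map_eq)

theorem measurePreserving_prod_fst_sub (ν : Measure E) [SFinite ν] :
    MeasurePreserving (fun p : E × E => (p.1, p.1 - p.2)) (ν.prod volume) (ν.prod volume) :=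
  (MeasurePreserving.id _).skew_product (g := fun ζ z => ζ - z) (by fun_prop)
    (Filter.Eventually.of_forall fun ζ =>
      (Measure.measurePreserving_sub_left (volume : Measure E) ζ).map_eq)

theorem integrable_sphere_translate {v : E → ℝ} (hv : Integrable v) (ρ : ℝ) :
    Integrable (fun p : Metric.sphere (0 : E) 1 × E => v (p.2 + ρ • (p.1 : E)))
      ((volume : Measure E).toSphere.prod volume) :=
  (measurePreserving_sphere_translate ρ).integrable_comp_of_integrable
    (hv.comp_snd (volume : Measure E).toSphere)

theorem ae_ae_sphere_translate {p : E → Prop} (hp : ∀ᵐ x, p x) (ρ : ℝ) :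
    ∀ᵐ z : E, ∀ᵐ ξ : Metric.sphere (0 : E) 1 ∂(volume : Measure E).toSphere,
      p (z + ρ • (ξ : E)) := by
  have h1 : ∀ᵐ q : Metric.sphere (0 : E) 1 × E ∂((volume : Measure E).toSphere.prod volume),
      p q.2 := Measure.quasiMeasurePreserving_snd.ae hp
  have h2 := (measurePreserving_sphere_translate (E := E) ρ).quasiMeasurePreserving.ae h1
  have h3 := (Measure.measurePreserving_swap (μ := (volume : Measure E))
    (ν := (volume : Measure E).toSphere)).quasiMeasurePreserving.ae h2
  exact Measure.ae_ae_of_ae_prod h3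

variable [Nontrivial E]

theorem integrable_greenKernel_sub (ν : Measure E) [IsFiniteMeasure ν] (ρ : ℝ) :
    Integrable (fun p : E × E => greenKernel ρ (p.1 - p.2)) (ν.prod volume) :=
  (measurePreserving_prod_fst_sub ν).integrable_comp_of_integrable
    ((integrable_greenKernel ρ).comp_snd ν)

/-- The total mass of the Green potential of a finite measure. -/
theorem lintegral_greenPotential_le (ν : Measure E) [IsFiniteMeasure ν] {ρ : ℝ} (hρ : 0 ≤ ρ) :
    ∫⁻ z, ‖∫ ζ, greenKernel ρ (ζ - z) ∂ν‖ₑ ≤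
      ENNReal.ofReal (ρ ^ 2 / (2 * Module.finrank ℝ E)) * ν Set.univ := by
  have hm : Measurable fun p : E × E => ‖greenKernel ρ (p.1 - p.2)‖ₑ :=
    ((measurable_greenKernel ρ).comp (by fun_prop)).enorm
  calc ∫⁻ z, ‖∫ ζ, greenKernel ρ (ζ - z) ∂ν‖ₑ
      ≤ ∫⁻ z, ∫⁻ ζ, ‖greenKernel ρ (ζ - z)‖ₑ ∂ν :=
        lintegral_mono fun z => enorm_integral_le_lintegral_enorm _
    _ = ∫⁻ ζ, (∫⁻ z, ‖greenKernel ρ (ζ - z)‖ₑ) ∂ν :=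
        (lintegral_lintegral_swap (f := fun ζ z => ‖greenKernel ρ (ζ - z)‖ₑ) hm.aemeasurable).symm
    _ = ∫⁻ _, ENNReal.ofReal (ρ ^ 2 / (2 * Module.finrank ℝ E)) ∂ν := by
        refine lintegral_congr fun ζ => ?_
        rw [(Measure.measurePreserving_sub_left (volume : Measure E) ζ).lintegral_comp
          (f := fun x => ‖greenKernel ρ x‖ₑ) (measurable_greenKernel ρ).enorm,
          ← integral_greenKernel hρ,
          ofReal_integral_eq_lintegral_ofReal (integrable_greenKernel ρ)
            (Filter.Eventually.of_forall (greenKernel_nonneg ρ))]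
        exact lintegral_congr fun x => Real.enorm_of_nonneg (greenKernel_nonneg ρ x)
    _ = _ := by rw [lintegral_const]

open scoped Convolution Pointwise in
/-- The Riesz–Jensen formula: if `Δv = ν` in the sense of distributions on `W`, then the mean of
`v` over almost every sphere of radius `ρ` whose ball lies in `W` exceeds the value at the centre
by the Green potential of `ν`. By duality this reduces to the case of test functions. -/
theorem ae_sphere_mean_sub_eq_greenPotential {v : E → ℝ} (hv : Integrable v) {ν : Measure E}
    [IsFiniteMeasure ν] {V W : Set E} {ρ : ℝ} (hρ : 0 ≤ ρ) (hV : IsOpen V)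
    (hVW : ∀ z ∈ V, Metric.closedBall z ρ ⊆ W)
    (hΔ : ∀ φ : E → ℝ, ContDiff ℝ ∞ φ → HasCompactSupport φ → tsupport φ ⊆ W →
      ∫ z, v z * Laplacian.laplacian φ z = ∫ z, φ z ∂ν) :
    ∀ᵐ z, z ∈ V → ((volume : Measure E).toSphere.real Set.univ)⁻¹ *
      ∫ ξ : Metric.sphere (0 : E) 1, v (z + ρ • (ξ : E)) ∂(volume : Measure E).toSphere - v z =
        ∫ ζ, greenKernel ρ (ζ - z) ∂ν := by
  set σ := (volume : Measure E).toSphere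
  set c := (σ.real Set.univ)⁻¹
  set L := ContinuousLinearMap.mul ℝ ℝ
  set g : E → ℝ := greenKernel ρ with hg
  have hgi : Integrable g := integrable_greenKernel ρ
  have hvs := integrable_sphere_translate hv ρ
  have hmi : Integrable fun z => c * ∫ ξ : Metric.sphere (0 : E) 1, v (z + ρ • (ξ : E)) ∂σ :=
    hvs.integral_prod_right.const_mul c
  have hGi : Integrable fun z => ∫ ζ, g (ζ - z) ∂ν :=
    (integrable_greenKernel_sub ν ρ).integral_prod_right
  suffices h : ∀ᵐ z, z ∈ V → (c * ∫ ξ : Metric.sphere (0 : E) 1, v (z + ρ • (ξ : E)) ∂σ - v z) -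
      ∫ ζ, g (ζ - z) ∂ν = 0 by
    filter_upwards [h] with z hz hzV using sub_eq_zero.1 (hz hzV)
  refine hV.ae_eq_zero_of_integral_contDiff_smul_eq_zero
    (((hmi.sub hv).sub hGi).locallyIntegrable.locallyIntegrableOn _) fun φ hφ hφc hφV => ?_
  obtain ⟨C, hC⟩ := hφc.exists_bound_of_continuous hφ.continuous
  have hmul : ∀ {f : E → ℝ}, Integrable f → Integrable fun z => φ z * f z := fun hf =>
    hf.bdd_mul hφ.continuous.aestronglyMeasurable (Filter.Eventually.of_forall hC)
  simp only [smul_eq_mul, mul_sub]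
  have hmv : Integrable fun z => φ z * (c * ∫ ξ : Metric.sphere (0 : E) 1,
      v (z + ρ • (ξ : E)) ∂σ) - φ z * v z := (hmul hmi).sub (hmul hv)
  rw [integral_sub hmv (hmul hGi), integral_sub (hmul hmi) (hmul hv),
    sub_eq_zero]
  -- the test function to which the hypothesis applies is the Green potential of `φ`
  have hgs : Function.support g ⊆ Metric.closedBall 0 ρ := by
    intro x hx
    by_contra hx'
    exact hx (greenKernel_eq_zero (le_of_lt (by simpa using hx')))
  have hgc : HasCompactSupport g :=
    HasCompactSupport.of_support_subset_isCompact (isCompact_closedBall 0 ρ) hgs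
  set Φ : E → ℝ := g ⋆[L] φ with hΦ
  have hΦs : ContDiff ℝ ∞ Φ := hφc.contDiff_convolution_right (n := ⊤) L hgi.locallyIntegrable hφ
  have hΦc : HasCompactSupport Φ := hgc.convolution L hφc
  have hΦW : tsupport Φ ⊆ W := by
    have h1 : tsupport Φ ⊆ Metric.closedBall 0 ρ + tsupport φ := by
      refine closure_minimal ?_ ((isCompact_closedBall 0 ρ).add hφc).isClosed
      exact (support_convolution_subset L).trans (Set.add_subset_add hgs (subset_tsupport φ))
    refine h1.trans ?_
    rintro _ ⟨x, hx, z, hz, rfl⟩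
    refine hVW z (hφV hz) ?_
    simpa using hx
  have hΔΦ : ∀ x, Laplacian.laplacian Φ x =
      c * ∫ ξ : Metric.sphere (0 : E) 1, φ (x - ρ • (ξ : E)) ∂σ - φ x := by
    intro x
    rw [hΦ, laplacian_convolution hgi.locallyIntegrable hφ hφc, convolution_def]
    simp only [ContinuousLinearMap.mul_apply', ← laplacian_comp_sub hφ x]
    rw [hg, integral_greenKernel_mul_laplacian hρ (φ := fun y => φ (x - y))
      (hφ.comp (contDiff_const.sub contDiff_id))
      (hφc.comp_homeomorph (Homeomorph.subLeft x)), sub_zero]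
  have hcont : Continuous fun p : Metric.sphere (0 : E) 1 × E => φ (p.2 - ρ • (p.1 : E)) :=
    hφ.continuous.comp (by fun_prop)
  have hI : Integrable (fun p : Metric.sphere (0 : E) 1 × E => v p.2 * φ (p.2 - ρ • (p.1 : E)))
      (σ.prod volume) :=
    (hv.comp_snd σ).mul_bdd hcont.aestronglyMeasurable (Filter.Eventually.of_forall fun p => hC _)
  have hI' : Integrable (fun p : Metric.sphere (0 : E) 1 × E => φ p.2 * v (p.2 + ρ • (p.1 : E)))
      (σ.prod volume) :=
    hvs.bdd_mul (hφ.continuous.comp continuous_snd).aestronglyMeasurable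
      (Filter.Eventually.of_forall fun p => hC _)
  have hJ : Integrable (fun p : E × E => φ p.2 * g (p.1 - p.2)) (ν.prod volume) :=
    (integrable_greenKernel_sub ν ρ).bdd_mul
      (hφ.continuous.comp continuous_snd).aestronglyMeasurable
      (Filter.Eventually.of_forall fun p => hC _)
  have hswap : ∫ x, v x * ∫ ξ : Metric.sphere (0 : E) 1, φ (x - ρ • (ξ : E)) ∂σ =
      ∫ z, φ z * ∫ ξ : Metric.sphere (0 : E) 1, v (z + ρ • (ξ : E)) ∂σ := by
    simp only [← integral_const_mul]
    rw [← integral_integral_swap (f := fun (ξ : Metric.sphere (0 : E) 1) x =>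
      v x * φ (x - ρ • (ξ : E))) hI, ← integral_integral_swap
        (f := fun (ξ : Metric.sphere (0 : E) 1) z => φ z * v (z + ρ • (ξ : E))) hI']
    refine integral_congr_ae (Filter.Eventually.of_forall fun ξ => ?_)
    simp only
    rw [← integral_add_right_eq_self _ (ρ • (ξ : E))]
    simp [mul_comm]
  have hv1 : Integrable fun x => v x * (c * ∫ ξ : Metric.sphere (0 : E) 1,
      φ (x - ρ • (ξ : E)) ∂σ) := by
    have := hI.integral_prod_right.const_mul c
    refine this.congr (Filter.Eventually.of_forall fun x => ?_)
    simp only [integral_const_mul]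
    ring
  calc (∫ z, φ z * (c * ∫ ξ : Metric.sphere (0 : E) 1, v (z + ρ • (ξ : E)) ∂σ)) - ∫ z, φ z * v z
      = ∫ x, v x * Laplacian.laplacian Φ x := by
        simp only [hΔΦ, mul_sub]
        have hv2 : Integrable fun x => v x * φ x := by simpa [mul_comm] using hmul hv
        rw [integral_sub hv1 hv2]
        simp only [mul_left_comm _ c, integral_const_mul, hswap]
        simp only [mul_comm]
    _ = ∫ ζ, Φ ζ ∂ν := hΔ Φ hΦs hΦc hΦW
    _ = ∫ ζ, (∫ z, φ z * g (ζ - z)) ∂ν := by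
        refine integral_congr_ae (Filter.Eventually.of_forall fun ζ => ?_)
        simp only [hΦ]
        rw [convolution_eq_swap]
        simp [L, mul_comm]
    _ = ∫ z, φ z * ∫ ζ, g (ζ - z) ∂ν := by
        rw [integral_integral_swap hJ]
        simp only [integral_const_mul]

end RieszJensen

/-! ### Plurisubharmonic functions are locally integrable -/

section Plurisubharmonic

variable {n : ℕ} {u : Cn n → EReal} {Ω : Set (Cn n)}

theorem UpperSemicontinuousOn.measurable_piecewise_bot {X : Type*} [TopologicalSpace X]
    [MeasurableSpace X] [BorelSpace X] {f : X → EReal} {s : Set X} [DecidablePred (· ∈ s)]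
    (hf : UpperSemicontinuousOn f s) (hs : IsOpen s) :
    Measurable (s.piecewise f fun _ => ⊥) := by
  refine measurable_of_Iio fun a => ?_
  have h : IsOpen {x ∈ s | f x < a} := by
    rw [isOpen_iff_mem_nhds]
    rintro x ⟨hx, hxa⟩
    have := hf x hx a hxa
    rw [hs.nhdsWithin_eq hx] at this
    filter_upwards [this, hs.mem_nhds hx] with y hy hys using ⟨hys, hy⟩
  rcases eq_or_ne a ⊥ with rfl | ha
  · simp
  have : (s.piecewise f fun _ => ⊥) ⁻¹' Set.Iio a = {x ∈ s | f x < a} ∪ sᶜ := by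
    ext x
    by_cases hx : x ∈ s <;> simp [hx, bot_lt_iff_ne_bot.2 ha]
  rw [this]
  exact h.measurableSet.union hs.measurableSet.compl

/-- A positive part bounded by `M` and an integral bounded below control the negative part. -/
theorem lintegral_neg_toENNReal_le_of_le_extIntegral {X : Type*} [MeasurableSpace X]
    {ν : Measure X} [IsProbabilityMeasure ν] {f : X → EReal} {M : ℝ≥0∞}
    (hf : ∀ x, (f x).toENNReal ≤ M) {a : EReal} (h : a ≤ extIntegral ν f) :
    ∫⁻ x, (-f x).toENNReal ∂ν ≤ M + (-a).toENNReal := by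
  rcases eq_or_ne a ⊥ with rfl | ha
  · simp
  rcases eq_or_ne M ⊤ with rfl | hM
  · simp
  set P := ∫⁻ x, (f x).toENNReal ∂ν with hP
  set Q := ∫⁻ x, (-f x).toENNReal ∂ν with hQ
  have hPM : P ≤ M := (lintegral_mono hf).trans (by simp)
  have h1 : a ≤ (M : EReal) - Q :=
    h.trans (EReal.sub_le_sub (by exact_mod_cast hPM) le_rfl)
  have hQt : Q ≠ ⊤ := by
    rintro hq
    rw [hq] at h1
    simp at h1
    exact ha h1
  have h2 : (Q : EReal) ≤ M + (-a) := by
    clear_value Q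
    lift M to NNReal using hM
    lift Q to NNReal using hQt
    induction a with
    | bot => exact absurd rfl ha
    | top => exact absurd h1 (by rw [not_le]; exact EReal.coe_lt_top ((M : ℝ) - Q))
    | coe a =>
      have h1' : (a : EReal) ≤ (((M : ℝ) - (Q : ℝ) : ℝ) : EReal) := h1
      rw [EReal.coe_le_coe_iff] at h1'
      change ((Q : ℝ) : EReal) ≤ (((M : ℝ) + (-a) : ℝ) : EReal)
      rw [EReal.coe_le_coe_iff]
      linarith
  rw [← EReal.coe_ennreal_le_coe_ennreal_iff, EReal.coe_ennreal_add]
  refine h2.trans ?_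
  gcongr
  rw [EReal.coe_toENNReal_eq_max]
  exact le_max_right _ _

/-- Multiplication by a complex number of modulus one preserves Lebesgue measure. -/
theorem measurePreserving_smul_of_norm_eq_one {τ : ℂ} (hτ : ‖τ‖ = 1) :
    MeasurePreserving (fun w : Cn n => τ • w) volume volume := by
  have hτ0 : τ ≠ 0 := by rintro rfl; simp at hτ
  let e : Cn n ≃ₗ[ℝ] Cn n := (LinearEquiv.smulOfNeZero ℂ (Cn n) τ hτ0).restrictScalars ℝ
  let e' : Cn n ≃ₗᵢ[ℝ] Cn n := ⟨e, fun w => by simp [e, norm_smul, hτ]⟩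
  exact e'.measurePreserving

theorem IsPlurisubharmonicOn.exists_upper_bound (hu : IsPlurisubharmonicOn u Ω)
    {K : Set (Cn n)} (hK : IsCompact K) (hKΩ : K ⊆ Ω) :
    ∃ M : ℝ≥0∞, M ≠ ⊤ ∧ ∀ z ∈ K, (u z).toENNReal ≤ M := by
  refine hK.induction_on (p := fun s => ∃ M : ℝ≥0∞, M ≠ ⊤ ∧ ∀ z ∈ s, (u z).toENNReal ≤ M)
    ⟨0, by simp, by simp⟩ ?_ ?_ ?_
  · rintro s t hst ⟨M, hM, h⟩
    exact ⟨M, hM, fun z hz => h z (hst hz)⟩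
  · rintro s t ⟨M, hM, h⟩ ⟨M', hM', h'⟩
    refine ⟨max M M', by simp [hM, hM'], ?_⟩
    rintro z (hz | hz)
    · exact (h z hz).trans (le_max_left _ _)
    · exact (h' z hz).trans (le_max_right _ _)
  · intro x hx
    obtain ⟨b, hb, hbt⟩ := exists_between (hu.lt_top x (hKΩ hx))
    have := hu.upperSemicontinuousOn x (hKΩ hx) b hb
    refine ⟨{z | u z < b}, nhdsWithin_mono x hKΩ this, b.toENNReal, ?_, fun z hz =>
      EReal.toENNReal_le_toENNReal (le_of_lt hz)⟩
    exact EReal.toENNReal_ne_top_iff.2 hbt.ne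

/-- The negative part of a plurisubharmonic function is integrable over balls about points where
the function is finite: average the sub-mean value property over all complex lines through the
centre. -/
theorem IsPlurisubharmonicOn.setLIntegral_ball_neg_lt_top (hu : IsPlurisubharmonicOn u Ω)
    (hΩ : IsOpen Ω) {z : Cn n} (hz : u z ≠ ⊥) {R : ℝ} (hR : Metric.closedBall z R ⊆ Ω) :
    ∫⁻ w in Metric.ball z R, (-u w).toENNReal < ⊤ := by
  classical
  obtain ⟨M, hM, hM'⟩ := hu.exists_upper_bound (isCompact_closedBall z R) hR
  have hzt : (-u z).toENNReal ≠ ⊤ := by simpa using hz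
  set f : Cn n → ℝ≥0∞ := (Metric.ball z R).indicator fun w => (-u w).toENNReal with hf
  have hfm : Measurable f := by
    have h1 := (hu.upperSemicontinuousOn.measurable_piecewise_bot hΩ)
    have h2 : f = (Metric.ball z R).indicator
        fun w => (-(Ω.piecewise u (fun _ => ⊥) w)).toENNReal := by
      ext w
      by_cases hw : w ∈ Metric.ball z R
      · have : w ∈ Ω := hR (Metric.ball_subset_closedBall hw)
        simp [hf, hw, this]
      · simp [hf, hw]
    rw [h2]
    exact h1.neg.ereal_toENNReal.indicator Metric.isOpen_ball.measurableSet
  let e : ℝ → ℂ := fun s => Complex.exp (2 * Real.pi * s * Complex.I)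
  have he : ∀ s, ‖e s‖ = 1 := fun s => by
    have := Complex.norm_exp_ofReal_mul_I (2 * Real.pi * s)
    simpa [e] using this
  have hec : Continuous e := by fun_prop
  have hcirc : ∀ w ∈ Metric.ball (0 : Cn n) R,
      ∫⁻ s in Set.Icc (0 : ℝ) 1, f (z + e s • w) ≤ M + (-u z).toENNReal := by
    intro w hw
    have hw' : ‖w‖ < R := by simpa using hw
    have hdisc : ∀ τ : ℂ, ‖τ‖ ≤ 1 → z + τ • w ∈ Metric.ball z R := fun τ hτ => by
      simp only [mem_ball_iff_norm, add_sub_cancel_left, norm_smul]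
      nlinarith [norm_nonneg w, norm_nonneg τ]
    have : IsProbabilityMeasure (volume.restrict (Set.Icc (0 : ℝ) 1)) := ⟨by simp⟩
    have h1 := hu.le_circleMean z (hR (Metric.mem_closedBall_self
      ((norm_nonneg w).trans hw'.le))) w fun τ hτ => hR (Metric.ball_subset_closedBall (hdisc τ hτ))
    have h2 := lintegral_neg_toENNReal_le_of_le_extIntegral
      (fun s => hM' _ (Metric.ball_subset_closedBall (hdisc (e s) (he s).le))) h1
    refine le_trans (lintegral_mono fun s => ?_) h2
    simp only [hf]
    exact Set.indicator_le_self _ _ _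
  have hrot : ∀ s, ∫⁻ w in Metric.ball (0 : Cn n) R, f (z + e s • w) = ∫⁻ w, f w := by
    intro s
    have h1 : ∀ w, (Metric.ball (0 : Cn n) R).indicator (fun w => f (z + e s • w)) w =
        f (z + e s • w) := by
      intro w
      by_cases hw : w ∈ Metric.ball (0 : Cn n) R
      · simp [hw]
      · rw [Set.indicator_of_notMem hw]
        refine (Set.indicator_of_notMem ?_ _).symm
        simpa [norm_smul, he s] using hw
    rw [← lintegral_indicator Metric.isOpen_ball.measurableSet, lintegral_congr h1,
      (measurePreserving_smul_of_norm_eq_one (he s)).lintegral_comp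
        (f := fun w => f (z + w)) (hfm.comp (by fun_prop)), lintegral_add_left_eq_self]
  have hjm : Measurable fun p : Cn n × ℝ => f (z + e p.2 • p.1) :=
    hfm.comp (Continuous.measurable (by fun_prop))
  rw [← lintegral_indicator Metric.isOpen_ball.measurableSet]
  calc ∫⁻ w, f w = ∫⁻ s in Set.Icc (0 : ℝ) 1, ∫⁻ w in Metric.ball (0 : Cn n) R,
        f (z + e s • w) := by simp [hrot]
    _ = ∫⁻ w in Metric.ball (0 : Cn n) R, ∫⁻ s in Set.Icc (0 : ℝ) 1, f (z + e s • w) :=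
        (lintegral_lintegral_swap (f := fun w s => f (z + e s • w)) hjm.aemeasurable).symm
    _ ≤ ∫⁻ _ in Metric.ball (0 : Cn n) R, (M + (-u z).toENNReal) :=
        setLIntegral_mono measurable_const hcirc
    _ < ⊤ := by
        rw [setLIntegral_const]
        exact ENNReal.mul_lt_top (ENNReal.add_lt_top.2 ⟨hM.lt_top, hzt.lt_top⟩)
          measure_ball_lt_top

/-- A plurisubharmonic function `≢ -∞` on a connected open set has a locally integrable negative
part: the set of points near which this is so is open, closed in `Ω`, and not empty. -/
theorem IsPlurisubharmonicOn.setLIntegral_neg_lt_top (hu : IsPlurisubharmonicOn u Ω)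
    (hΩ : IsOpen Ω) (hΩc : IsPreconnected Ω) (hne : ∃ z ∈ Ω, u z ≠ ⊥) {K : Set (Cn n)}
    (hK : IsCompact K) (hKΩ : K ⊆ Ω) :
    ∫⁻ w in K, (-u w).toENNReal < ⊤ := by
  let S : Set (Cn n) := {z | ∃ R > 0, ∫⁻ w in Metric.ball z R, (-u w).toENNReal < ⊤}
  have hSo : IsOpen S := by
    rw [Metric.isOpen_iff]
    rintro z ⟨R, hR, h⟩
    refine ⟨R / 2, by positivity, fun y hy => ⟨R / 2, by positivity, ?_⟩⟩
    refine lt_of_le_of_lt (lintegral_mono_set (Metric.ball_subset_ball' ?_)) h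
    have : dist y z < R / 2 := hy
    linarith
  have hcore : ∀ z ∈ Ω, u z ≠ ⊥ → z ∈ S := by
    intro z hz hzb
    obtain ⟨R, hR, h⟩ := Metric.nhds_basis_closedBall.mem_iff.1 (hΩ.mem_nhds hz)
    exact ⟨R, hR, hu.setLIntegral_ball_neg_lt_top hΩ hzb h⟩
  have hΩS : Ω ⊆ S := by
    refine hΩc.subset_of_closure_inter_subset hSo ?_ ?_
    · obtain ⟨z, hz, hzb⟩ := hne
      exact ⟨z, hz, hcore z hz hzb⟩
    · rintro z ⟨hzS, hz⟩
      obtain ⟨R, hR, h⟩ := Metric.nhds_basis_closedBall.mem_iff.1 (hΩ.mem_nhds hz)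
      obtain ⟨y, hyS, hy⟩ := Metric.mem_closure_iff.1 hzS (R / 3) (by positivity)
      obtain ⟨T, hT, hTi⟩ := hyS
      -- near `y` the function is finite almost everywhere, so it is finite close to `z`
      obtain ⟨x, hxy, hxb⟩ : ∃ x ∈ Metric.ball y (min T (R / 6)), u x ≠ ⊥ := by
        by_contra! hcon
        refine absurd hTi (not_lt.2 ?_)
        refine le_trans ?_ (lintegral_mono_set
          (Metric.ball_subset_ball (min_le_left T (R / 6))))
        rw [setLIntegral_congr_fun (g := fun _ => ⊤) Metric.isOpen_ball.measurableSet
          fun w hw => by simp [hcon w hw], setLIntegral_const, ENNReal.top_mul]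
        exact (Metric.measure_ball_pos _ _ (by positivity)).ne'
      have hxy' : dist x y < R / 6 := lt_of_lt_of_le hxy (min_le_right _ _)
      have hxz : dist x z < R / 2 := by
        have := dist_triangle x y z
        rw [dist_comm y z] at this
        linarith
      refine ⟨R / 2 - dist x z, by linarith, ?_⟩
      refine lt_of_le_of_lt (lintegral_mono_set (Metric.ball_subset_ball' ?_))
        (hu.setLIntegral_ball_neg_lt_top hΩ hxb (R := R / 2)
          ((Metric.closedBall_subset_closedBall' ?_).trans h))
      · rw [dist_comm]; linarith
      · linarith
  refine hK.induction_on (p := fun s => ∫⁻ w in s, (-u w).toENNReal < ⊤) (by simp)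
    (fun s t hst h => (lintegral_mono_set hst).trans_lt h)
    (fun s t hs ht => (lintegral_union_le _ s t).trans_lt (ENNReal.add_lt_top.2 ⟨hs, ht⟩)) ?_
  intro x hx
  obtain ⟨R, hR, h⟩ := hΩS (hKΩ hx)
  exact ⟨_, mem_nhdsWithin_of_mem_nhds (Metric.ball_mem_nhds x hR), h⟩

end Plurisubharmonic

/-! ### Distance to the boundary and defining functions -/

section Boundary

theorem ball_infDist_frontier_subset {X : Type*} [NormedAddCommGroup X] [NormedSpace ℝ X]
    {Ω : Set X} (hΩ : IsOpen Ω) {z : X} (hz : z ∈ Ω) :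
    Metric.ball z (Metric.infDist z (frontier Ω)) ⊆ Ω := by
  rcases le_or_gt (Metric.infDist z (frontier Ω)) 0 with h0 | h0
  · rw [Metric.ball_eq_empty.2 h0]; exact Set.empty_subset _
  refine (convex_ball z _).isPreconnected.subset_of_closure_inter_subset hΩ
    ⟨z, Metric.mem_ball_self h0, hz⟩ ?_
  rintro y ⟨hy, hyz⟩
  by_contra hyΩ
  have hyf : y ∈ frontier Ω := ⟨hy, by rwa [hΩ.interior_eq]⟩
  have := Metric.infDist_le_dist_of_mem hyf (x := z)
  rw [Metric.mem_ball, dist_comm] at hyz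
  linarith

variable {n : ℕ} {Ω : Set (Cn n)}

theorem isOpen_innerDomain (hΩ : IsOpen Ω) (δ : ℝ) : IsOpen (innerDomain Ω δ) :=
  hΩ.inter (isOpen_lt continuous_const (Metric.continuous_infDist_pt _))

theorem closedBall_subset_innerDomain (hΩ : IsOpen Ω) {δ : ℝ} (hδ : 0 < δ) {z : Cn n}
    (hz : z ∈ innerDomain Ω δ) : Metric.closedBall z (δ / 2) ⊆ innerDomain Ω (δ / 2) := by
  intro y hy
  have hd : dist y z ≤ δ / 2 := hy
  have hz2 : δ < Metric.infDist z (frontier Ω) := hz.2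
  refine ⟨ball_infDist_frontier_subset hΩ hz.1 ?_, ?_⟩
  · rw [Metric.mem_ball]; linarith
  · have := Metric.infDist_le_infDist_add_dist (s := frontier Ω) (x := z) (y := y)
    rw [dist_comm] at this
    linarith

theorem exists_isCompact_innerDomain_subset (hΩb : Bornology.IsBounded Ω)
    {δ : ℝ} (hδ : 0 < δ) : ∃ K, IsCompact K ∧ innerDomain Ω δ ⊆ K ∧ K ⊆ Ω := by
  refine ⟨closure Ω ∩ {z | δ ≤ Metric.infDist z (frontier Ω)},
    hΩb.isCompact_closure.inter_right
      (isClosed_le continuous_const (Metric.continuous_infDist_pt _)), ?_, ?_⟩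
  · rintro z ⟨hz, hd⟩
    exact ⟨subset_closure hz, hd.le⟩
  · rintro z ⟨hz, hd⟩
    by_contra hzΩ
    have hzf : z ∈ frontier Ω := ⟨hz, fun h => hzΩ (interior_subset h)⟩
    have hd' : δ ≤ Metric.infDist z (frontier Ω) := hd
    rw [Metric.infDist_zero_of_mem hzf] at hd'
    linarith

/-- Near a boundary point `-r` dominates a multiple of the boundary distance: moving along a
direction in which `r` increases at a definite rate, one has to leave `Ω` before `r` turns
positive. -/
theorem exists_mul_infDist_le_of_mem_frontier (hΩ : IsOpen Ω) {r : Cn n → ℝ} {U : Set (Cn n)}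
    (hU : IsOpen U) (hr : ContDiffOn ℝ ∞ r U) (hneg : ∀ z ∈ Ω, r z < 0) {z₀ : Cn n}
    (hz₀ : z₀ ∈ frontier Ω) (hz₀U : z₀ ∈ U) (hd : fderiv ℝ r z₀ ≠ 0) :
    ∃ a > 0, ∃ η > 0, ∀ z ∈ Metric.ball z₀ η ∩ Ω, a * Metric.infDist z (frontier Ω) ≤ -r z := by
  obtain ⟨w, hw⟩ : ∃ w, 0 < fderiv ℝ r z₀ w := by
    by_contra! h
    refine hd (ContinuousLinearMap.ext fun w => le_antisymm (h w) ?_)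
    have := h (-w)
    rw [map_neg] at this
    simpa using this
  have hw0 : 0 < ‖w‖ := by
    rw [norm_pos_iff]
    rintro rfl
    simp at hw
  -- normalize the direction to a unit vector
  set v : Cn n := ‖w‖⁻¹ • w with hv
  have hvn : ‖v‖ = 1 := by rw [hv, norm_smul, norm_inv, norm_norm, inv_mul_cancel₀ hw0.ne']
  have hvd : 0 < fderiv ℝ r z₀ v := by
    rw [hv, map_smul, smul_eq_mul]; positivity
  set a := fderiv ℝ r z₀ v / 2 with ha
  have hcont : ContinuousAt (fun z => fderiv ℝ r z v) z₀ :=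
    ((hr.continuousOn_fderiv_of_isOpen hU (by simp)).continuousAt
      (hU.mem_nhds hz₀U)).clm_apply continuousAt_const
  have hev : ∀ᶠ z in nhds z₀, z ∈ U ∧ a < fderiv ℝ r z v :=
    (hU.eventually_mem hz₀U).and (hcont.eventually_const_lt (by rw [ha]; linarith))
  obtain ⟨η, hη, hball⟩ := Metric.eventually_nhds_iff_ball.1 hev
  refine ⟨a, by rw [ha]; positivity, η / 2, by positivity, ?_⟩
  rintro z ⟨hz, hzΩ⟩
  set d := Metric.infDist z (frontier Ω)
  have hzd : dist z z₀ < η / 2 := hz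
  have hdη : d ≤ dist z z₀ := Metric.infDist_le_dist_of_mem hz₀
  by_contra! hcon
  have hrz := hneg z hzΩ
  have ha0 : 0 < a := by rw [ha]; positivity
  -- a point of the ball of radius `d` about `z` where `r` would have to be positive
  obtain ⟨t, ht1, ht2⟩ : ∃ t, -r z / a < t ∧ t < d :=
    exists_between ((div_lt_iff₀ ha0).2 (by linarith))
  have ht0 : 0 < t := lt_trans (div_pos (by linarith) ha0) ht1
  have hin : ∀ s ∈ Set.Icc 0 t, z + s • v ∈ Metric.ball z₀ η := by
    intro s hs
    rw [Metric.mem_ball]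
    have h1 : dist (z + s • v) z = s := by
      rw [dist_eq_norm, add_sub_cancel_left, norm_smul, hvn, mul_one, Real.norm_of_nonneg hs.1]
    have := dist_triangle (z + s • v) z z₀
    have := hs.2
    linarith
  have hder : ∀ s ∈ Set.Icc 0 t,
      HasDerivAt (fun s : ℝ => r (z + s • v)) (fderiv ℝ r (z + s • v) v) s := by
    intro s hs
    have hU' := (hball _ (hin s hs)).1
    have h1 : HasFDerivAt r (fderiv ℝ r (z + s • v)) (z + s • v) :=
      ((hr.contDiffAt (hU.mem_nhds hU')).differentiableAt (by simp)).hasFDerivAt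
    have h2 : HasDerivAt (fun s : ℝ => z + s • v) v s := by
      simpa using ((hasDerivAt_id s).smul_const v).const_add z
    exact h1.comp_hasDerivAt s h2
  have hmv := (convex_Icc 0 t).mul_sub_le_image_sub_of_le_deriv
    (f := fun s : ℝ => r (z + s • v)) (C := a)
    (fun s hs => (hder s hs).continuousAt.continuousWithinAt)
    (fun s hs => (hder s (interior_subset hs)).differentiableAt.differentiableWithinAt)
    (fun s hs => by
      rw [(hder s (interior_subset hs)).deriv]
      exact (hball _ (hin s (interior_subset hs))).2.le)
    0 ⟨le_rfl, ht0.le⟩ t ⟨ht0.le, le_rfl⟩ ht0.le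
  have hout : r (z + t • v) < 0 := by
    refine hneg _ (ball_infDist_frontier_subset hΩ hzΩ ?_)
    rw [mem_ball_iff_norm, add_sub_cancel_left, norm_smul, hvn, mul_one,
      Real.norm_of_nonneg ht0.le]
    exact ht2
  rw [div_lt_iff₀ ha0] at ht1
  simp only [sub_zero, zero_smul, add_zero] at hmv
  linarith

theorem IsSmoothDefiningFunction.exists_mul_infDist_le {r : Cn n → ℝ}
    (hr : IsSmoothDefiningFunction r Ω) (hΩ : IsOpen Ω) (hΩb : Bornology.IsBounded Ω) :
    ∃ a > 0, ∀ z ∈ Ω, a * Metric.infDist z (frontier Ω) ≤ -r z := by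
  obtain ⟨U, hU, hΩU, hrU, hΩr, hd⟩ := hr
  have hneg : ∀ z ∈ Ω, r z < 0 := fun z hz => by
    rw [hΩr] at hz; exact hz.2
  have key : ∃ a > 0, ∀ z ∈ closure Ω ∩ Ω, a * Metric.infDist z (frontier Ω) ≤ -r z := by
    refine hΩb.isCompact_closure.induction_on
      (p := fun s => ∃ a > 0, ∀ z ∈ s ∩ Ω, a * Metric.infDist z (frontier Ω) ≤ -r z)
      ⟨1, one_pos, by simp⟩ ?_ ?_ ?_
    · rintro s t hst ⟨a, ha, h⟩
      exact ⟨a, ha, fun z hz => h z ⟨hst hz.1, hz.2⟩⟩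
    · rintro s t ⟨a, ha, h⟩ ⟨b, hb, h'⟩
      refine ⟨min a b, lt_min ha hb, ?_⟩
      rintro z ⟨hz | hz, hzΩ⟩
      · exact (mul_le_mul_of_nonneg_right (min_le_left _ _) Metric.infDist_nonneg).trans
          (h z ⟨hz, hzΩ⟩)
      · exact (mul_le_mul_of_nonneg_right (min_le_right _ _) Metric.infDist_nonneg).trans
          (h' z ⟨hz, hzΩ⟩)
    · intro z₀ hz₀
      by_cases hz₀Ω : z₀ ∈ Ω
      · have hrz := hneg z₀ hz₀Ω
        have hrc : ContinuousAt r z₀ := hrU.continuousOn.continuousAt (hU.mem_nhds (hΩU hz₀))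
        set b := Metric.infDist z₀ (frontier Ω) + 1 with hb
        have hb0 : 0 < b := by
          have := Metric.infDist_nonneg (x := z₀) (s := frontier Ω)
          linarith
        refine ⟨_, mem_nhdsWithin_of_mem_nhds ((hrc.eventually_lt_const
          (show r z₀ < r z₀ / 2 by linarith)).and
          ((Metric.continuous_infDist_pt (frontier Ω)).continuousAt.eventually_lt_const
            (show Metric.infDist z₀ (frontier Ω) < b by linarith))),
          -r z₀ / 2 / b, by apply div_pos _ hb0; linarith, ?_⟩
        rintro z ⟨⟨h1, h2⟩, -⟩
        calc -r z₀ / 2 / b * Metric.infDist z (frontier Ω) ≤ -r z₀ / 2 / b * b :=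
              mul_le_mul_of_nonneg_left h2.le (div_nonneg (by linarith) hb0.le)
          _ = -r z₀ / 2 := by field_simp
          _ ≤ -r z := by linarith
      · have hz₀f : z₀ ∈ frontier Ω := ⟨hz₀, by rwa [hΩ.interior_eq]⟩
        obtain ⟨a, ha, η, hη, h⟩ := exists_mul_infDist_le_of_mem_frontier hΩ hU hrU hneg hz₀f
          (hΩU hz₀) (hd z₀ hz₀f)
        exact ⟨_, mem_nhdsWithin_of_mem_nhds (Metric.ball_mem_nhds z₀ hη), a, ha, h⟩
  obtain ⟨a, ha, h⟩ := key
  exact ⟨a, ha, fun z hz => h z ⟨subset_closure hz, hz⟩⟩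

end Boundary

/-! ### The mean value estimate -/

section MeanValue

theorem enorm_toReal_le (x : EReal) : ‖x.toReal‖ₑ ≤ x.toENNReal + (-x).toENNReal := by
  induction x with
  | bot => simp
  | top => simp
  | coe x =>
    rw [← EReal.coe_neg, EReal.real_coe_toENNReal, EReal.real_coe_toENNReal, EReal.toReal_coe,
      Real.enorm_eq_ofReal_abs]
    rcases le_total 0 x with h | h
    · rw [abs_of_nonneg h]; exact le_self_add
    · rw [abs_of_nonpos h]; exact le_add_self

/-- For an almost everywhere finite function with integrable real part, `extIntegral` is the
Bochner integral. -/
theorem extIntegral_eq_integral {X : Type*} [MeasurableSpace X] {ν : Measure X} {f : X → EReal}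
    (hi : Integrable (fun x => (f x).toReal) ν) (hb : ∀ᵐ x ∂ν, f x ≠ ⊥) (ht : ∀ᵐ x ∂ν, f x ≠ ⊤) :
    extIntegral ν f = ((∫ x, (f x).toReal ∂ν : ℝ) : EReal) := by
  have h1 : ∫⁻ x, (f x).toENNReal ∂ν = ∫⁻ x, ENNReal.ofReal (f x).toReal ∂ν := by
    refine lintegral_congr_ae ?_
    filter_upwards [ht] with x hx
    rw [EReal.toENNReal_of_ne_top hx]
  have h2 : ∫⁻ x, (-f x).toENNReal ∂ν = ∫⁻ x, ENNReal.ofReal (-(f x).toReal) ∂ν := by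
    refine lintegral_congr_ae ?_
    filter_upwards [hb] with x hx
    rw [EReal.toENNReal_of_ne_top (by simpa using hx), EReal.toReal_neg_eq]
  have hp : ∫⁻ x, ENNReal.ofReal (f x).toReal ∂ν ≠ ⊤ :=
    (lintegral_ofReal_le_lintegral_enorm _).trans_lt hi.2 |>.ne
  have hn : ∫⁻ x, ENNReal.ofReal (-(f x).toReal) ∂ν ≠ ⊤ :=
    (lintegral_ofReal_le_lintegral_enorm _).trans_lt hi.neg.2 |>.ne
  rw [extIntegral, h1, h2, integral_eq_lintegral_pos_part_sub_lintegral_neg_part hi,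
    EReal.coe_sub, EReal.coe_ennreal_toReal hp, EReal.coe_ennreal_toReal hn]

variable {n : ℕ} {u : Cn n → EReal} {Ω W K : Set (Cn n)}

theorem IsPlurisubharmonicOn.aemeasurable_restrict (hu : IsPlurisubharmonicOn u Ω)
    (hΩ : IsOpen Ω) (hW : MeasurableSet W) (hWΩ : W ⊆ Ω) :
    AEMeasurable u (volume.restrict W) := by
  classical
  refine (hu.upperSemicontinuousOn.measurable_piecewise_bot hΩ).aemeasurable.congr ?_
  filter_upwards [ae_restrict_mem hW] with w hw
  simp [hWΩ hw]

theorem IsPlurisubharmonicOn.ae_ne_bot (hu : IsPlurisubharmonicOn u Ω) (hΩ : IsOpen Ω)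
    (hΩc : IsPreconnected Ω) (hne : ∃ z ∈ Ω, u z ≠ ⊥) (hW : MeasurableSet W)
    (hK : IsCompact K) (hWK : W ⊆ K) (hKΩ : K ⊆ Ω) :
    ∀ᵐ z, z ∈ W → u z ≠ ⊥ := by
  rw [← ae_restrict_iff' hW]
  have h := (lintegral_mono_set hWK).trans_lt (hu.setLIntegral_neg_lt_top hΩ hΩc hne hK hKΩ)
  have hm := (hu.aemeasurable_restrict hΩ hW (hWK.trans hKΩ)).neg.ereal_toENNReal
  filter_upwards [ae_lt_top' hm h.ne] with z hz
  rintro hb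
  simp [hb] at hz

theorem IsPlurisubharmonicOn.integrable_indicator_toReal (hu : IsPlurisubharmonicOn u Ω)
    (hΩ : IsOpen Ω) (hΩc : IsPreconnected Ω) (hne : ∃ z ∈ Ω, u z ≠ ⊥) (hW : MeasurableSet W)
    (hK : IsCompact K) (hWK : W ⊆ K) (hKΩ : K ⊆ Ω) :
    Integrable (W.indicator fun z => (u z).toReal) := by
  rw [integrable_indicator_iff hW]
  refine ⟨(hu.aemeasurable_restrict hΩ hW (hWK.trans hKΩ)).ereal_toReal.aestronglyMeasurable, ?_⟩
  obtain ⟨M, hM, hM'⟩ := hu.exists_upper_bound hK hKΩ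
  calc ∫⁻ z in W, ‖(u z).toReal‖ₑ ≤ ∫⁻ z in K, ‖(u z).toReal‖ₑ := lintegral_mono_set hWK
    _ ≤ ∫⁻ z in K, (M + (-u z).toENNReal) := by
        refine setLIntegral_mono' hK.measurableSet fun z hz => ?_
        exact (enorm_toReal_le _).trans (by gcongr; exact hM' z hz)
    _ = M * volume K + ∫⁻ z in K, (-u z).toENNReal := by
        rw [lintegral_add_left measurable_const, setLIntegral_const]
    _ < ⊤ := ENNReal.add_lt_top.2 ⟨ENNReal.mul_lt_top hM.lt_top hK.measure_lt_top,
        hu.setLIntegral_neg_lt_top hΩ hΩc hne hK hKΩ⟩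

theorem integral_unitSphereProb (f : Metric.sphere (0 : Cn n) 1 → ℝ) :
    ∫ ξ, f ξ ∂unitSphereProb n = ((volume : Measure (Cn n)).toSphere.real Set.univ)⁻¹ *
      ∫ ξ, f ξ ∂(volume : Measure (Cn n)).toSphere := by
  rw [unitSphereProb, integral_smul_measure, ENNReal.toReal_inv, smul_eq_mul, measureReal_def]

/-- The unweighted estimate: the `L¹` norm of the excess of the spherical mean is at most the
integral `ρ² / (2N)` of the Green kernel times the mass of `Δu`; here `ρ = δ/2` and `N = 2n`. -/
theorem IsPlurisubharmonicOn.L1Norm_sphericalMean_sub_le (hn : 1 ≤ n)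
    (hu : IsPlurisubharmonicOn u Ω) (hΩ : IsOpen Ω) (hΩc : IsPreconnected Ω)
    (hΩb : Bornology.IsBounded Ω) (hne : ∃ z ∈ Ω, u z ≠ ⊥) {μ : Measure (Cn n)}
    (hμ : IsLaplacianMeasure u Ω μ) {δ : ℝ} (hδ : 0 < δ) :
    L1Norm (fun z => sphericalMean u (δ / 2) z - u z) (innerDomain Ω δ) ≤
      ENNReal.ofReal ((δ / 2) ^ 2 / (4 * n)) * μ (innerDomain Ω (δ / 2)) := by
  have : Nontrivial (Cn n) := by
    have : 0 < Module.finrank ℂ (Cn n) := by simp; omega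
    exact Module.nontrivial_of_finrank_pos this
  have hN : Module.finrank ℝ (Cn n) = 2 * n := by simp [finrank_real_of_complex]
  set V := innerDomain Ω δ with hV
  set W := innerDomain Ω (δ / 2) with hW
  have hVo : IsOpen V := isOpen_innerDomain hΩ δ
  have hWm : MeasurableSet W := (isOpen_innerDomain hΩ (δ / 2)).measurableSet
  have hVW : ∀ z ∈ V, Metric.closedBall z (δ / 2) ⊆ W := fun z hz =>
    closedBall_subset_innerDomain hΩ hδ hz
  obtain ⟨K, hK, hWK, hKΩ⟩ := exists_isCompact_innerDomain_subset hΩb (half_pos hδ)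
  have hWΩ : W ⊆ Ω := hWK.trans hKΩ
  have : IsFiniteMeasure (μ.restrict W) :=
    ⟨by simpa using (measure_mono hWK).trans_lt (hμ.finite_on_compact K hK hKΩ)⟩
  set v : Cn n → ℝ := W.indicator fun z => (u z).toReal with hv
  have hvi : Integrable v := hu.integrable_indicator_toReal hΩ hΩc hne hWm hK hWK hKΩ
  have hbot : ∀ᵐ z, z ∈ W → u z ≠ ⊥ := hu.ae_ne_bot hΩ hΩc hne hWm hK hWK hKΩ
  have hΔ : ∀ φ : Cn n → ℝ, ContDiff ℝ ∞ φ → HasCompactSupport φ → tsupport φ ⊆ W →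
      ∫ z, v z * Laplacian.laplacian φ z = ∫ z, φ z ∂(μ.restrict W) := by
    intro φ hφ hφc hφW
    rw [setIntegral_eq_integral_of_forall_compl_eq_zero fun z hz =>
      image_eq_zero_of_notMem_tsupport fun h => hz (hφW h),
      ← hμ.integral_eq φ hφ hφc (hφW.trans hWΩ)]
    refine integral_congr_ae (Filter.Eventually.of_forall fun z => ?_)
    by_cases hz : z ∈ W
    · simp [hv, hz]
    · have : Laplacian.laplacian φ z = 0 := by
        by_contra h
        exact hz (hφW (support_laplacian_subset hφ h))
      simp [this]
  have hRJ := ae_sphere_mean_sub_eq_greenPotential hvi (ν := μ.restrict W) (half_pos hδ).le hVo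
    hVW hΔ
  have hint := (integrable_sphere_translate hvi (δ / 2)).prod_left_ae
  have hpt : ∀ᵐ z, z ∈ V → (sphericalMean u (δ / 2) z - u z).abs =
      ‖∫ ζ, greenKernel (δ / 2) (ζ - z) ∂(μ.restrict W)‖ₑ := by
    filter_upwards [hRJ, hint, hbot, ae_ae_sphere_translate hbot (δ / 2)] with z h1 h2 h3 h4 hz
    have hzW : z ∈ W := hVW z hz (Metric.mem_closedBall_self (half_pos hδ).le)
    have hξW : ∀ ξ : Metric.sphere (0 : Cn n) 1, z + (δ / 2) • (ξ : Cn n) ∈ W := fun ξ => by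
      refine hVW z hz ?_
      simp [norm_smul, abs_of_pos hδ]
    have hvξ : ∀ ξ : Metric.sphere (0 : Cn n) 1, v (z + (δ / 2) • (ξ : Cn n)) =
        (u (z + (δ / 2) • (ξ : Cn n))).toReal := fun ξ => Set.indicator_of_mem (hξW ξ) _
    have hac : unitSphereProb n ≪ (volume : Measure (Cn n)).toSphere :=
      Measure.smul_absolutelyContinuous
    have hmean : sphericalMean u (δ / 2) z = ((((volume : Measure (Cn n)).toSphere.real Set.univ)⁻¹ *
        ∫ ξ : Metric.sphere (0 : Cn n) 1, v (z + (δ / 2) • (ξ : Cn n))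
          ∂(volume : Measure (Cn n)).toSphere : ℝ) : EReal) := by
      rw [sphericalMean, extIntegral_eq_integral, integral_unitSphereProb]
      · simp only [hvξ]
      · refine Integrable.smul_measure ?_ (ENNReal.inv_ne_top.2
          (Measure.measure_univ_ne_zero.2 (Measure.toSphere_ne_zero _)))
        simpa only [hvξ] using h2
      · filter_upwards [hac.ae_le h4] with ξ hξ using hξ (hξW ξ)
      · exact Filter.Eventually.of_forall fun ξ => (hu.lt_top _ (hWΩ (hξW ξ))).ne
    have huz : u z = ((v z : ℝ) : EReal) := by
      rw [hv, Set.indicator_of_mem hzW,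
        EReal.coe_toReal (hu.lt_top z (hWΩ hzW)).ne (h3 hzW)]
    rw [hmean, huz, ← EReal.coe_sub, h1 hz, EReal.abs_def, Real.enorm_eq_ofReal_abs]
  calc L1Norm (fun z => sphericalMean u (δ / 2) z - u z) V
      = ∫⁻ z in V, ‖∫ ζ, greenKernel (δ / 2) (ζ - z) ∂(μ.restrict W)‖ₑ := by
        refine lintegral_congr_ae ?_
        rw [Filter.EventuallyEq, ae_restrict_iff' hVo.measurableSet]
        exact hpt
    _ ≤ ∫⁻ z, ‖∫ ζ, greenKernel (δ / 2) (ζ - z) ∂(μ.restrict W)‖ₑ := setLIntegral_le_lintegral _ _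
    _ ≤ ENNReal.ofReal ((δ / 2) ^ 2 / (2 * Module.finrank ℝ (Cn n))) * μ.restrict W Set.univ :=
        lintegral_greenPotential_le _ (half_pos hδ).le
    _ = ENNReal.ofReal ((δ / 2) ^ 2 / (4 * n)) * μ W := by
        rw [hN, Measure.restrict_apply_univ]
        congr 3
        push_cast
        ring

/-- Where `-r` dominates a multiple of the boundary distance, its powers are bounded below on
`innerDomain Ω δ`. -/
theorem ofReal_rpow_mul_measure_le_weightedMass (hΩ : IsOpen Ω) {r : Cn n → ℝ} {a : ℝ}
    (ha : 0 < a) (hr : ∀ z ∈ Ω, a * Metric.infDist z (frontier Ω) ≤ -r z) {p : ℝ} (hp : 0 ≤ p)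
    (μ : Measure (Cn n)) {δ : ℝ} (hδ : 0 ≤ δ) :
    ENNReal.ofReal ((a * δ) ^ p) * μ (innerDomain Ω δ) ≤
      weightedMass (fun z => (-r z) ^ p) μ (innerDomain Ω δ) := by
  rw [weightedMass, ← setLIntegral_const]
  refine setLIntegral_mono' (isOpen_innerDomain hΩ δ).measurableSet fun z hz => ?_
  refine ENNReal.ofReal_le_ofReal (Real.rpow_le_rpow (by positivity) ?_ hp)
  exact (mul_le_mul_of_nonneg_left (le_of_lt hz.2) ha.le).trans (hr z hz.1)

end MeanValue

theorem theorem3p1 {n : ℕ} (hn : 1 ≤ n) (Ω : Set (Cn n)) (hΩo : IsOpen Ω)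
    (hΩc : IsConnected Ω) (hΩb : Bornology.IsBounded Ω)
    (r : Cn n → ℝ) (hr : IsSmoothDefiningFunction r Ω) (ε : ℝ) (hε : 0 < ε) :
    ∃ C : ℝ, 0 < C ∧
      ∀ u : Cn n → EReal, IsPlurisubharmonicOn u Ω → (∃ z ∈ Ω, u z ≠ ⊥) →
      ∀ μ : Measure (Cn n), IsLaplacianMeasure u Ω μ →
      ∀ δ : ℝ, 0 < δ →
        L1Norm (fun z => sphericalMean u (δ / 2) z - u z) (innerDomain Ω δ) ≤
          ENNReal.ofReal (C * δ ^ (1 - ε)) *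
            weightedMass (fun z => (-r z) ^ (1 + ε)) μ (innerDomain Ω (δ / 2)) := by
  obtain ⟨a, ha, har⟩ := hr.exists_mul_infDist_le hΩo hΩb
  have hn' : (0 : ℝ) < n := by exact_mod_cast hn
  refine ⟨(2 / a) ^ (1 + ε) / (16 * n), by positivity, ?_⟩
  intro u hu hne μ hμ δ hδ
  -- `C` is chosen to make the unweighted constant `(δ/2)² / (4n)` absorb the weight, since `-r ≥ a δ / 2` on the domain of integration
  have hconst : (δ / 2) ^ 2 / (4 * n) =
      (2 / a) ^ (1 + ε) / (16 * n) * δ ^ (1 - ε) * (a * (δ / 2)) ^ (1 + ε) := by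
    have h1 : (2 / a) ^ (1 + ε) * (a * (δ / 2)) ^ (1 + ε) = δ ^ (1 + ε) := by
      rw [← Real.mul_rpow (by positivity) (by positivity)]
      congr 1
      field_simp
    have h2 : δ ^ (1 - ε) * δ ^ (1 + ε) = δ ^ 2 := by
      rw [← Real.rpow_add hδ, ← Real.rpow_natCast]
      congr 1
      push_cast
      ring
    calc (δ / 2) ^ 2 / (4 * n) = δ ^ 2 / (16 * n) := by ring
      _ = δ ^ (1 - ε) * ((2 / a) ^ (1 + ε) * (a * (δ / 2)) ^ (1 + ε)) / (16 * n) := by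
          rw [h1, h2]
      _ = _ := by ring
  refine (hu.L1Norm_sphericalMean_sub_le hn hΩo hΩc.isPreconnected hΩb hne hμ hδ).trans ?_
  rw [hconst, ENNReal.ofReal_mul (by positivity), mul_assoc]
  gcongr
  exact ofReal_rpow_mul_measure_le_weightedMass hΩo ha har (by linarith) μ (by positivity)
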